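/- **Theorem (Leader Completeness).** Consider either of the following two algorithms (simplified MultiPaxos in the style of Raft, or Raft), run by $n$ servers with ids $0,\dots,n-1$ that communicate by messages. In every execution: if an operation $op$ is committed at index $i$ by a leader in term $t$, then every leader of any term $t'>t$ has operation $op$ at index $i$ of its log, at every moment at which it is leader of term $t'$. Here $op$ *is committed at index $i$ by a leader in term $t$* if at some moment the leader of term $t$ has $op$ at index $i$ of its log and its commit index is at least $i$. *State.* Each server is a follower, candidate or leader (initially follower) and has a current term (initially $0$), a log (a finite list of entries, i.e. pairs of an operation and a term, indexed from $1$, initially empty), a commit index and a last-applied index (initially $0$); in Raft also the candidate it voted for in its current term, if any. Servers may crash and restart at any time, keeping only term, vote and log. Messages may be delayed arbitrarily (the statement even allows loss, duplication and reordering). A majority is a set of more than $n/2$ servers. Each request and each response carries the current term of its sender; a server that receives one with a term greater than its own first adopts that term and becomes a follower without a vote. Responses are matched with their requests, and responses to requests of an earlier term of the requester are ignored. *Elections.* At any time a follower (in Raft also a candidate) $s$ may become a candidate: it raises its term to the next larger $t$ with $t \bmod n = s$ (Paxos), or by one, voting for itself (Raft), and sends RequestVote with its term, its commit index (Paxos)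 and the index and term of its last entry (Raft) to all other servers. A receiver with a greater term refuses. Otherwise, in Paxos it grants the vote and sends with it all its log entries after the candidate's commit index; in Raft it grants the vote if it has not voted for another candidate in this term and the candidate's last entry has a greater term than its own last entry, or the same term and at least the same index. A candidate with votes of a majority (itself included) may become leader. In Paxos it first replaces its log after its commit index: each index that occurs among the entries received with the votes and its own entries gets the operation with the greatest term among these, with the candidate's current term. In Raft its log is unchanged. *Replication.* A leader appends operations received from clients to its log, with its current term. For each other server it keeps nextIndex (initially its commit index plus one in Paxos, its last log index plus one in Raft) and matchIndex (initially $0$). It sends AppendEntries with its term, the index $p=\text{nextIndex}-1$ and the term of its entry there, its commit index, and either no entries or its log entries starting at nextIndex (all of them up to the end of its log; in Raft possibly only the first few of them). A receiver with a greater term refuses; in Raft a candidate becomes a follower. If $p\neq 0$ and the receiver has no entry at $p$ with the stated term, it responds negatively. Otherwise, at the first index where its log has an entry with a term different from the new one, it deletes this entry and all that follow; it appends the new entries that are missing, raises its commit index to the minimum of the leader's commit index and the index of the last new entry ($p$ if there is none) if this is larger, and responds positively. On a positive response the leader sets nextIndex to one more than the index of the last entry of the request and raises matchIndex to that index; on a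 negative response of its own term it decrements nextIndex (not below $1$). A leader may raise its commit index to $N$, at most its last log index, if a majority, itself included, has matchIndex at least $N$; in Raft only if its entry at $N$ has its current term. A server may apply operations up to its commit index. -/

import Mathlib

namespace Consensus

/-- The two algorithms: the simplified MultiPaxos and Raft, presented in the same style.
They share every rule below except where the rule branches on the algorithm. -/
inductive Algorithm where
  | paxos
  | raft

/-- A log entry: an operation together with a term. -/
structure Entry (Op : Type*) where
  op : Op
  term : ℕ

/-- The entry of a log at a given index; the first index is `1`. -/
def entryAt {Op : Type*} (log : List (Entry Op)) (i : ℕ) : Option (Entry Op) :=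
  if i = 0 then none else log[i - 1]?

/-- The term of the entry at index `i` (`0` if there is none; terms of leaders are positive). -/
def termAt {Op : Type*} (log : List (Entry Op)) (i : ℕ) : ℕ :=
  ((entryAt log i).map Entry.term).getD 0

/-- The entries of a log after index `c`, each with its index. -/
def entriesAfter {Op : Type*} (log : List (Entry Op)) (c : ℕ) : Set (ℕ × Entry Op) :=
  {p | c < p.1 ∧ entryAt log p.1 = some p.2}

inductive Role where
  | follower
  | candidate
  | leader

/-- The local state of one of the `n` servers. -/
structure Server (n : ℕ) (Op : Type*) where
  role : Role
  /-- persistent -/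
  currentTerm : ℕ
  /-- persistent (used by Raft only) -/
  votedFor : Option (Fin n)
  /-- persistent -/
  log : List (Entry Op)
  commitIndex : ℕ
  lastApplied : ℕ
  /-- candidates: the servers whose vote was received, the candidate itself included -/
  votes : Finset (Fin n)
  /-- candidates: the log entries received with votes, with their indices (used by Paxos only) -/
  entries : Set (ℕ × Entry Op)
  /-- leaders -/
  nextIndex : Fin n → ℕ
  /-- leaders -/
  matchIndex : Fin n → ℕ

/-- Arguments of the RequestVote RPC: `leaderCommit` (the commit index of the candidate) is read
in Paxos only, the last two in Raft only. The candidate's id is the sender of the message. -/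
structure VoteArgs where
  term : ℕ
  leaderCommit : ℕ
  lastLogIndex : ℕ
  lastLogTerm : ℕ

/-- Arguments of the AppendEntries RPC. -/
structure AppendArgs (Op : Type*) where
  term : ℕ
  prevLogIndex : ℕ
  prevLogTerm : ℕ
  entries : List (Entry Op)
  leaderCommit : ℕ

/-- Messages from `src` to `dst`. A response carries the arguments `a` of the request that it
answers, the current term of the responder and its results. -/
inductive Message (n : ℕ) (Op : Type*) where
  | voteRequest (src dst : Fin n) (a : VoteArgs)
  | voteReply (src dst : Fin n) (a : VoteArgs) (term : ℕ) (granted : Bool)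
      (entries : Set (ℕ × Entry Op))
  | appendRequest (src dst : Fin n) (a : AppendArgs Op)
  | appendReply (src dst : Fin n) (a : AppendArgs Op) (term : ℕ) (success : Bool)

/-- The receiver of a message. -/
def Message.dst {n : ℕ} {Op : Type*} : Message n Op → Fin n
  | .voteRequest _ d _ => d
  | .voteReply _ d _ _ _ _ => d
  | .appendRequest _ d _ => d
  | .appendReply _ d _ _ _ => d

/-- The term of the sender, included in each request and each response. -/
def Message.term {n : ℕ} {Op : Type*} : Message n Op → ℕ
  | .voteRequest _ _ a => a.term
  | .voteReply _ _ _ T _ _ => T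
  | .appendRequest _ _ a => a.term
  | .appendReply _ _ _ T _ => T

/-- A global state: the states of the servers and the set of all messages sent so far.
A message in this set may be received at any time, in any order, any number of times or never;
so the executions over reliable in-order channels are among the executions considered here. -/
structure State (n : ℕ) (Op : Type*) where
  server : Fin n → Server n Op
  network : Set (Message n Op)

/-- Server `s` moves to the local state `v` and sends the messages `out`. -/
def State.update {n : ℕ} {Op : Type*} (x : State n Op) (s : Fin n) (v : Server n Op)
    (out : Set (Message n Op)) : State n Op where
  server := Function.update x.server s v
  network := x.network ∪ out

/-- The state of a server on first boot. -/
def Server.init (n : ℕ) (Op : Type*) : Server n Op where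
  role := .follower
  currentTerm := 0
  votedFor := none
  log := []
  commitIndex := 0
  lastApplied := 0
  votes := ∅
  entries := ∅
  nextIndex := fun _ => 1
  matchIndex := fun _ => 0

def State.init (n : ℕ) (Op : Type*) : State n Op where
  server := fun _ => Server.init n Op
  network := ∅

/-- More than half of the `n` servers. -/
def IsMajority {n : ℕ} (Q : Finset (Fin n)) : Prop := n < 2 * Q.card

/-- The term `t` in which server `s`, now in term `cur`, may start an election. -/
def IsNextTerm {n : ℕ} (alg : Algorithm) (s : Fin n) (cur t : ℕ) : Prop :=
  match alg with
  | .paxos => IsLeast {u : ℕ | cur < u ∧ u % n = s} t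
  | .raft => t = cur + 1

/-- Which servers start an election on a timeout: followers and, in Raft, candidates as well. -/
def MayTimeOut (alg : Algorithm) (r : Role) : Prop :=
  match alg with
  | .paxos => r = .follower
  | .raft => r = .follower ∨ r = .candidate

/-- `log'` is `log` up to index `c`; after `c` it has, at exactly the indices that occur in
`entries`, an operation with the greatest term among the `entries` at that index, now with
term `t`. -/
def IsMerge {Op : Type*} (c t : ℕ) (log : List (Entry Op)) (entries : Set (ℕ × Entry Op))
    (log' : List (Entry Op)) : Prop :=
  log'.take c = log.take c ∧
  ∀ i, c < i →
    match entryAt log' i with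
    | none => ∀ e, (i, e) ∉ entries
    | some e' => e'.term = t ∧
        ∃ e, (i, e) ∈ entries ∧ e.op = e'.op ∧ ∀ f, (i, f) ∈ entries → f.term ≤ e.term

/-- The log `log'` with which the candidate `v` becomes leader. -/
def IsLeaderLog {n : ℕ} {Op : Type*} (alg : Algorithm) (v : Server n Op)
    (log' : List (Entry Op)) : Prop :=
  match alg with
  | .paxos => IsMerge v.commitIndex v.currentTerm v.log v.entries log'
  | .raft => log' = v.log

/-- The initial value of `nextIndex` for a new leader. -/
def initialNextIndex {n : ℕ} {Op : Type*} (alg : Algorithm) (v : Server n Op) : ℕ :=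
  match alg with
  | .paxos => v.commitIndex + 1
  | .raft => v.log.length + 1

/-- The condition on a vote of `v` for candidate `c`, apart from the terms. -/
def MayVote {n : ℕ} {Op : Type*} (alg : Algorithm) (v : Server n Op) (c : Fin n)
    (a : VoteArgs) : Prop :=
  match alg with
  | .paxos => True
  | .raft => (v.votedFor = none ∨ v.votedFor = some c) ∧
      (termAt v.log v.log.length < a.lastLogTerm ∨
        (a.lastLogTerm = termAt v.log v.log.length ∧ v.log.length ≤ a.lastLogIndex))

/-- The vote remembered by a server that votes for `c`. -/
def voteFor {n : ℕ} (alg : Algorithm) (old : Option (Fin n)) (c : Fin n) : Option (Fin n) :=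
  match alg with
  | .paxos => old
  | .raft => some c

/-- The log entries to be sent with a vote, or recorded by a new candidate. -/
def voteEntries {Op : Type*} (alg : Algorithm) (log : List (Entry Op)) (c : ℕ) :
    Set (ℕ × Entry Op) :=
  match alg with
  | .paxos => entriesAfter log c
  | .raft => ∅

/-- The (nonempty) entries that a leader may send from the part `rest` of its log that starts at
`nextIndex`: all of them; in Raft, also only the first few of them. -/
def MaySend {Op : Type*} (alg : Algorithm) (rest es : List (Entry Op)) : Prop :=
  match alg with
  | .paxos => es = rest
  | .raft => es <+: rest ∧ es ≠ []

/-- The role after an AppendEntries request of the current term. -/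
def roleOnAppend (alg : Algorithm) (r : Role) : Role :=
  match alg, r with
  | .raft, .candidate => .follower
  | _, r => r

/-- The additional condition of Raft for the new commit index `N`. -/
def MayCommit {n : ℕ} {Op : Type*} (alg : Algorithm) (v : Server n Op) (N : ℕ) : Prop :=
  match alg with
  | .paxos => True
  | .raft => termAt v.log N = v.currentTerm

/-- Existing entries against new ones, starting at the same index: at the first index where the
terms differ, the existing entry and all that follow it are deleted; new entries not already
present are appended. -/
def overwrite {Op : Type*} : List (Entry Op) → List (Entry Op) → List (Entry Op)
  | old, [] => old
  | [], e :: es => e :: es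
  | o :: os, e :: es => if o.term = e.term then o :: overwrite os es else e :: es

/-- The log of a follower after storing the entries `es` that follow index `prev`. -/
def storeEntries {Op : Type*} (log : List (Entry Op)) (prev : ℕ) (es : List (Entry Op)) :
    List (Entry Op) :=
  log.take prev ++ overwrite (log.drop prev) es

/-- The consistency check of AppendEntries (trivial at the start of the log). -/
def PrevMatches {Op : Type*} (log : List (Entry Op)) (a : AppendArgs Op) : Prop :=
  a.prevLogIndex = 0 ∨ ∃ e, entryAt log a.prevLogIndex = some e ∧ e.term = a.prevLogTerm

/-- The arguments of an AppendEntries request of the leader `v` to server `j` with entries `es`. -/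
def appendArgs {n : ℕ} {Op : Type*} (v : Server n Op) (j : Fin n) (es : List (Entry Op)) :
    AppendArgs Op where
  term := v.currentTerm
  prevLogIndex := v.nextIndex j - 1
  prevLogTerm := termAt v.log (v.nextIndex j - 1)
  entries := es
  leaderCommit := v.commitIndex

/-- One step of the system; `s` is the server that takes it and `x.server s` its local state. -/
inductive Step {n : ℕ} {Op : Type*} (alg : Algorithm) (x : State n Op) : State n Op → Prop
  /-- Election timeout: become a candidate in a new term and ask all other servers for votes. -/
  | timeout (s : Fin n) (t : ℕ) (hrole : MayTimeOut alg (x.server s).role)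
      (hterm : IsNextTerm alg s (x.server s).currentTerm t) :
      Step alg x (x.update s
        { x.server s with
          role := .candidate
          currentTerm := t
          votedFor := voteFor alg none s
          votes := {s}
          entries := voteEntries alg (x.server s).log (x.server s).commitIndex }
        {m | ∃ j, j ≠ s ∧ m = .voteRequest s j
          { term := t
            leaderCommit := (x.server s).commitIndex
            lastLogIndex := (x.server s).log.length
            lastLogTerm := termAt (x.server s).log (x.server s).log.length }})
  /-- A candidate with votes from a majority becomes leader. -/
  | becomeLeader (s : Fin n) (log' : List (Entry Op)) (hrole : (x.server s).role = .candidate)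
      (hvotes : IsMajority (x.server s).votes) (hlog : IsLeaderLog alg (x.server s) log') :
      Step alg x (x.update s
        { x.server s with
          role := .leader
          log := log'
          votes := ∅
          entries := ∅
          nextIndex := fun _ => initialNextIndex alg (x.server s)
          matchIndex := fun _ => 0 } ∅)
  /-- A leader receives an operation from a client and appends it to its log. -/
  | clientRequest (s : Fin n) (op : Op) (hrole : (x.server s).role = .leader) :
      Step alg x (x.update s
        { x.server s with
          log := (x.server s).log ++ [{ op := op, term := (x.server s).currentTerm }] } ∅)
  /-- A leader sends an empty AppendEntries request (heartbeat). -/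
  | heartbeat (s j : Fin n) (hrole : (x.server s).role = .leader) (hj : j ≠ s) :
      Step alg x (x.update s (x.server s)
        {.appendRequest s j (appendArgs (x.server s) j [])})
  /-- A leader sends log entries starting at `nextIndex`. -/
  | replicate (s j : Fin n) (es : List (Entry Op)) (hrole : (x.server s).role = .leader)
      (hj : j ≠ s) (hnext : (x.server s).nextIndex j ≤ (x.server s).log.length)
      (hes : MaySend alg ((x.server s).log.drop ((x.server s).nextIndex j - 1)) es) :
      Step alg x (x.update s (x.server s)
        {.appendRequest s j (appendArgs (x.server s) j es)})
  /-- A leader advances its commit index to `N`: a majority (the leader counts itself) is known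
  to have its log up to `N`. -/
  | advanceCommit (s : Fin n) (N : ℕ) (hrole : (x.server s).role = .leader)
      (hN : (x.server s).commitIndex < N) (hlen : N ≤ (x.server s).log.length)
      (hmaj : IsMajority (Finset.univ.filter fun j => j = s ∨ N ≤ (x.server s).matchIndex j))
      (hcommit : MayCommit alg (x.server s) N) :
      Step alg x (x.update s { x.server s with commitIndex := N } ∅)
  /-- A server applies the next committed operation to its state machine. -/
  | apply (s : Fin n) (h : (x.server s).lastApplied < (x.server s).commitIndex) :
      Step alg x (x.update s
        { x.server s with lastApplied := (x.server s).lastApplied + 1 } ∅)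
  /-- A server crashes and restarts: only the persistent state survives. -/
  | restart (s : Fin n) :
      Step alg x (x.update s
        { Server.init n Op with
          currentTerm := (x.server s).currentTerm
          votedFor := (x.server s).votedFor
          log := (x.server s).log } ∅)
  /-- A request or response with a greater term: adopt the term and become a follower. This
  comes before any other reaction to the message. -/
  | learnTerm (m : Message n Op) (hm : m ∈ x.network)
      (hterm : (x.server m.dst).currentTerm < m.term) :
      Step alg x (x.update m.dst
        { x.server m.dst with
          role := .follower
          currentTerm := m.term
          votedFor := none } ∅)
  /-- A vote is refused. -/
  | denyVote (c s : Fin n) (a : VoteArgs) (hm : .voteRequest c s a ∈ x.network)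
      (h : a.term < (x.server s).currentTerm ∨
        (a.term = (x.server s).currentTerm ∧ ¬ MayVote alg (x.server s) c a)) :
      Step alg x (x.update s (x.server s)
        {.voteReply s c a (x.server s).currentTerm false ∅})
  /-- A vote is granted; in Paxos, the log entries after `leaderCommit` are sent with it. -/
  | grantVote (c s : Fin n) (a : VoteArgs) (hm : .voteRequest c s a ∈ x.network)
      (hterm : a.term = (x.server s).currentTerm) (hvote : MayVote alg (x.server s) c a) :
      Step alg x (x.update s
        { x.server s with votedFor := voteFor alg (x.server s).votedFor c }
        {.voteReply s c a (x.server s).currentTerm true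
          (voteEntries alg (x.server s).log a.leaderCommit)})
  /-- A candidate receives a vote for its current candidacy. -/
  | receiveVote (v s : Fin n) (a : VoteArgs) (T : ℕ) (E : Set (ℕ × Entry Op))
      (hm : .voteReply v s a T true E ∈ x.network) (hrole : (x.server s).role = .candidate)
      (ha : a.term = (x.server s).currentTerm) (hT : T = (x.server s).currentTerm) :
      Step alg x (x.update s
        { x.server s with
          votes := insert v (x.server s).votes
          entries := (x.server s).entries ∪ E } ∅)
  /-- An AppendEntries request of an old term is refused. -/
  | refuseAppend (l s : Fin n) (a : AppendArgs Op) (hm : .appendRequest l s a ∈ x.network)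
      (hterm : a.term < (x.server s).currentTerm) :
      Step alg x (x.update s (x.server s)
        {.appendReply s l a (x.server s).currentTerm false})
  /-- An AppendEntries request fails because of a log inconsistency. -/
  | mismatchAppend (l s : Fin n) (a : AppendArgs Op) (hm : .appendRequest l s a ∈ x.network)
      (hterm : a.term = (x.server s).currentTerm) (hprev : ¬ PrevMatches (x.server s).log a) :
      Step alg x (x.update s
        { x.server s with role := roleOnAppend alg (x.server s).role }
        {.appendReply s l a (x.server s).currentTerm false})
  /-- An AppendEntries request succeeds. -/
  | acceptAppend (l s : Fin n) (a : AppendArgs Op) (hm : .appendRequest l s a ∈ x.network)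
      (hterm : a.term = (x.server s).currentTerm) (hprev : PrevMatches (x.server s).log a) :
      Step alg x (x.update s
        { x.server s with
          role := roleOnAppend alg (x.server s).role
          log := storeEntries (x.server s).log a.prevLogIndex a.entries
          commitIndex := max (x.server s).commitIndex
            (min a.leaderCommit (a.prevLogIndex + a.entries.length)) }
        {.appendReply s l a (x.server s).currentTerm true})
  /-- A leader receives a positive response to a request of its current term. -/
  | appendSucceeded (j s : Fin n) (a : AppendArgs Op) (T : ℕ)
      (hm : .appendReply j s a T true ∈ x.network) (hrole : (x.server s).role = .leader)
      (ha : a.term = (x.server s).currentTerm) (hT : T = (x.server s).currentTerm) :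
      Step alg x (x.update s
        { x.server s with
          nextIndex := Function.update (x.server s).nextIndex j
            (a.prevLogIndex + a.entries.length + 1)
          matchIndex := Function.update (x.server s).matchIndex j
            (max ((x.server s).matchIndex j) (a.prevLogIndex + a.entries.length)) } ∅)
  /-- A leader learns of a log inconsistency: decrement `nextIndex` (which stays positive). -/
  | appendFailed (j s : Fin n) (a : AppendArgs Op) (T : ℕ)
      (hm : .appendReply j s a T false ∈ x.network) (hrole : (x.server s).role = .leader)
      (ha : a.term = (x.server s).currentTerm) (hT : T = (x.server s).currentTerm) :
      Step alg x (x.update s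
        { x.server s with
          nextIndex := Function.update (x.server s).nextIndex j
            (max 1 ((x.server s).nextIndex j - 1)) } ∅)

/-- An execution: it starts in the initial state and proceeds by steps. It may pause, so that
finite executions are included. -/
def IsExecution {n : ℕ} {Op : Type*} (alg : Algorithm) (σ : ℕ → State n Op) : Prop :=
  σ 0 = State.init n Op ∧ ∀ k, σ (k + 1) = σ k ∨ Step alg (σ k) (σ (k + 1))

/-- In state `x`, server `s` is leader of term `t`. -/
def IsLeaderOf {n : ℕ} {Op : Type*} (x : State n Op) (s : Fin n) (t : ℕ) : Prop :=
  (x.server s).role = .leader ∧ (x.server s).currentTerm = t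

/-- In state `x`, the log of server `s` has operation `op` at index `i`. -/
def HasOpAt {n : ℕ} {Op : Type*} (x : State n Op) (s : Fin n) (i : ℕ) (op : Op) : Prop :=
  ∃ e, entryAt (x.server s).log i = some e ∧ e.op = op

/-- In the execution `σ`, operation `op` is committed at index `i` by a leader in term `t`:
at some point the leader of term `t` has `op` at index `i`, and its commit index has
reached `i`. -/
def CommittedInTerm {n : ℕ} {Op : Type*} (σ : ℕ → State n Op) (op : Op) (i t : ℕ) : Prop :=
  ∃ k s, IsLeaderOf (σ k) s t ∧ HasOpAt (σ k) s i op ∧ i ≤ ((σ k).server s).commitIndex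

end Consensus

/-! Logs are built from logs of leaders: if a log has an entry of term `T` at index `i`, then its
part up to `i` is a prefix of a log that the leader of `T` once had (`IsExecution.fromLeaders`). A
term has at most one leader (`IsExecution.leader_unique`), whose log only grows during the term
(`IsExecution.leader_log_mono`); so two logs with entries of equal term at an index agree up to it.
An accepted AppendEntries therefore changes nothing or replaces the log by a prefix of the sender's
log (`IsExecution.accept`).

A commit rests on a majority that stored the entry in the leader's term, an election on a majority
of votes, and these share a server. As its term never decreases, it stored the entry before voting
for a later term, and it has not lost it in between. Induction on time proves three statements
together: later leaders have what was chosen, servers that stored it keep it, and what lies below a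
commit index was chosen (`PaxosInv`, `RaftInv`).

In Paxos a choice concerns a single index, and a new leader takes the operation of greatest term.
Entries below a commit index keep old terms, so they need not reach every term in which the
operation was chosen again. The invariant hence refers to the first choosing term; entries of that
term or a later one all have the chosen operation (`IsExecution.op_eq_of_firstChosen`). In Raft a
whole prefix is chosen, and the comparison of logs before a vote passes it on
(`IsExecution.elect_of_chosenPrefix`). -/

namespace Consensus

/-! ### Logs as lists, and the effect of storing entries. -/

section Logs

variable {Op : Type*}

theorem entryAt_eq_some {l : List (Entry Op)} {i : ℕ} {e : Entry Op} :
    entryAt l i = some e ↔ 0 < i ∧ l[i - 1]? = some e := by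
  unfold entryAt
  split_ifs with h
  · simp [h]
  · simp [Nat.pos_of_ne_zero h]

theorem entryAt_bounds {l : List (Entry Op)} {i : ℕ} {e : Entry Op}
    (h : entryAt l i = some e) : 0 < i ∧ i ≤ l.length := by
  obtain ⟨h0, h1⟩ := entryAt_eq_some.1 h
  have := (List.getElem?_eq_some_iff.1 h1).1
  omega

theorem mem_of_entryAt {l : List (Entry Op)} {i : ℕ} {e : Entry Op}
    (h : entryAt l i = some e) : e ∈ l :=
  List.mem_of_getElem? (entryAt_eq_some.1 h).2

theorem exists_entryAt {l : List (Entry Op)} {i : ℕ} (h0 : 0 < i) (h1 : i ≤ l.length) :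
    ∃ e, entryAt l i = some e :=
  ⟨l[i - 1]'(by omega), entryAt_eq_some.2 ⟨h0, List.getElem?_eq_getElem _⟩⟩

theorem exists_entryAt_of_mem {l : List (Entry Op)} {e : Entry Op} (h : e ∈ l) :
    ∃ i, entryAt l i = some e := by
  obtain ⟨j, hj⟩ := List.mem_iff_getElem?.1 h
  exact ⟨j + 1, entryAt_eq_some.2 ⟨by omega, by simpa using hj⟩⟩

theorem entryAt_of_isPrefix {l l' : List (Entry Op)} (h : l <+: l') {i : ℕ} {e : Entry Op}
    (he : entryAt l i = some e) : entryAt l' i = some e := by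
  obtain ⟨h0, h1⟩ := entryAt_eq_some.1 he
  obtain ⟨r, rfl⟩ := h
  refine entryAt_eq_some.2 ⟨h0, ?_⟩
  rw [List.getElem?_append_left (List.getElem?_eq_some_iff.1 h1).1, h1]

theorem entryAt_take_of_le {l : List (Entry Op)} {i m : ℕ} (h : i ≤ m) :
    entryAt (l.take m) i = entryAt l i := by
  unfold entryAt
  split_ifs with h0
  · rfl
  · exact List.getElem?_take_of_lt (by omega)

theorem entryAt_eq_of_take_eq {l l' : List (Entry Op)} {i m : ℕ} (h : l.take m = l'.take m)
    (hi : i ≤ m) : entryAt l i = entryAt l' i := by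
  rw [← entryAt_take_of_le (l := l) hi, h, entryAt_take_of_le hi]

theorem entryAt_eq_of_isPrefix {l l' : List (Entry Op)} (h : l <+: l') {i : ℕ}
    (hi : i ≤ l.length) : entryAt l' i = entryAt l i := by
  obtain ⟨r, rfl⟩ := h
  unfold entryAt
  split_ifs with h0
  · rfl
  · exact List.getElem?_append_left (by omega)

theorem entryAt_concat {l : List (Entry Op)} {a e : Entry Op} {i : ℕ}
    (h : entryAt (l ++ [a]) i = some e) : entryAt l i = some e ∨ (i = l.length + 1 ∧ e = a) := by
  have hb := entryAt_bounds h
  rw [List.length_append, List.length_singleton] at hb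
  by_cases hi : i ≤ l.length
  · left
    rwa [entryAt_eq_of_isPrefix (List.prefix_append _ _) hi] at h
  · right
    have : i = l.length + 1 := by omega
    subst this
    refine ⟨rfl, ?_⟩
    have := (entryAt_eq_some.1 h).2
    simpa using this.symm

theorem termAt_of_entryAt {l : List (Entry Op)} {i : ℕ} {e : Entry Op}
    (h : entryAt l i = some e) : termAt l i = e.term := by
  simp [termAt, h]

theorem exists_of_termAt_pos {l : List (Entry Op)} {i : ℕ} (h : 0 < termAt l i) :
    ∃ e, entryAt l i = some e ∧ e.term = termAt l i := by
  unfold termAt at h ⊢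
  cases he : entryAt l i with
  | none => simp [he] at h
  | some e => exact ⟨e, rfl, by simp⟩

theorem prefix_total {a b c : List (Entry Op)} (ha : a <+: c) (hb : b <+: c) :
    a <+: b ∨ b <+: a :=
  (le_total a.length b.length).imp (List.prefix_of_prefix_length_le ha hb)
    (List.prefix_of_prefix_length_le hb ha)

/-- `overwrite` compares only terms. Under `h` equal terms mean equal entries, so whatever is kept
of `old` before a conflict also belongs to `es`. -/
theorem overwrite_eq {old es : List (Entry Op)}
    (h : ∀ (j : ℕ) (o e : Entry Op), old[j]? = some o → es[j]? = some e → o.term = e.term → o = e) :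
    (es <+: old ∧ overwrite old es = old) ∨ (¬ es <+: old ∧ overwrite old es = es) := by
  induction es generalizing old with
  | nil => left; cases old <;> simp [overwrite]
  | cons e es ih =>
    cases old with
    | nil => right; simp [overwrite]
    | cons o os =>
      by_cases hoe : o.term = e.term
      · have h0 : o = e := h 0 o e (by simp) (by simp) hoe
        subst h0
        have := ih (old := os) fun j a b ha hb hab =>
          h (j + 1) a b (by simpa using ha) (by simpa using hb) hab
        simpa [overwrite, List.cons_prefix_cons] using this
      · right
        refine ⟨fun hp => ?_, by simp [overwrite, hoe]⟩
        rw [List.cons_prefix_cons] at hp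
        exact hoe (by rw [hp.1])

/-- The log matching property for two logs. -/
def Agree (l l' : List (Entry Op)) : Prop :=
  ∀ i e f, entryAt l i = some e → entryAt l' i = some f → e.term = f.term →
    l.take i = l'.take i

theorem Agree.eq {l l' : List (Entry Op)} (h : Agree l l') {i : ℕ} {e f : Entry Op}
    (he : entryAt l i = some e) (hf : entryAt l' i = some f) (hef : e.term = f.term) : e = f := by
  have := entryAt_eq_of_take_eq (h i e f he hf hef) le_rfl
  rw [he, hf] at this
  exact Option.some.inj this

/-- Storing entries of a leader's log either leaves a log unchanged or replaces it by a prefix of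
the leader's log. -/
theorem storeEntries_eq {old l es : List (Entry Op)} {p : ℕ} (hagree : Agree old l)
    (hpos : ∀ e ∈ old, 0 < e.term) (hes : es <+: l.drop p)
    (hprev : p = 0 ∨ ∃ e, entryAt old p = some e ∧ e.term = termAt l p) :
    ∃ M, M <+: l ∧ M.length = p + es.length ∧ M = l.take p ++ es ∧ l.take p <+: old ∧
      ((M <+: old ∧ storeEntries old p es = old) ∨
        (¬ M <+: old ∧ storeEntries old p es = M)) := by
  have hp : p ≤ l.length ∧ old.take p = l.take p := by
    rcases hprev with rfl | ⟨e, he, hterm⟩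
    · simp
    · obtain ⟨f, hf, hft⟩ := exists_of_termAt_pos (hterm ▸ hpos e (mem_of_entryAt he))
      exact ⟨(entryAt_bounds hf).2, hagree _ _ _ he hf (by rw [hterm, hft])⟩
  obtain ⟨hpl, htake⟩ := hp
  have hold : l.take p ++ old.drop p = old := by rw [← htake, List.take_append_drop]
  obtain ⟨r, hr⟩ := hes
  refine ⟨l.take p ++ es, ⟨r, by rw [List.append_assoc, hr, List.take_append_drop]⟩,
    by simp [hpl], rfl, ⟨_, hold⟩, ?_⟩
  have key := overwrite_eq (old := old.drop p) (es := es) fun j o e ho he hoe => by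
    rw [List.getElem?_drop] at ho
    have he' : (l.drop p)[j]? = some e := by
      rw [← hr, List.getElem?_append_left (List.getElem?_eq_some_iff.1 he).1, he]
    rw [List.getElem?_drop] at he'
    exact hagree.eq (i := p + j + 1) (entryAt_eq_some.2 ⟨by omega, by simpa using ho⟩)
      (entryAt_eq_some.2 ⟨by omega, by simpa using he'⟩) hoe
  have hiff : l.take p ++ es <+: old ↔ es <+: old.drop p := by
    conv_lhs => rw [← hold]
    exact List.prefix_append_right_inj _
  rw [hiff, storeEntries, htake]
  rcases key with ⟨h1, h2⟩ | ⟨h1, h2⟩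
  · exact Or.inl ⟨h1, by rw [h2, hold]⟩
  · exact Or.inr ⟨h1, by rw [h2]⟩

end Logs

/-! ### Majorities, and steps as seen by a single server. -/

theorem exists_mem_of_isMajority {n : ℕ} {Q Q' : Finset (Fin n)} (h : IsMajority Q)
    (h' : IsMajority Q') : ∃ j, j ∈ Q ∧ j ∈ Q' := by
  by_contra! hne
  have hd : Disjoint Q Q' := Finset.disjoint_left.2 hne
  have h1 := Finset.card_le_univ (Q ∪ Q')
  rw [Finset.card_union_of_disjoint hd, Fintype.card_fin] at h1
  unfold IsMajority at h h'
  omega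

/-- The part of a step that concerns the server `s`, which moves to a new local state. -/
inductive LocalStep {n : ℕ} {Op : Type*} (alg : Algorithm) (x : State n Op) (s : Fin n) :
    Server n Op → Prop
  | quiet (v : Server n Op) (hrole : v.role = (x.server s).role ∨ v.role = .follower)
      (hterm : v.currentTerm = (x.server s).currentTerm)
      (hvote : ∀ c, alg = .raft → (x.server s).votedFor = some c → v.votedFor = some c)
      (hlog : v.log = (x.server s).log) (hcommit : v.commitIndex = (x.server s).commitIndex)
      (hvotes : v.votes = (x.server s).votes) (hentries : v.entries = (x.server s).entries)
      (hmatch : v.matchIndex = (x.server s).matchIndex) : LocalStep alg x s v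
  | timeout (t : ℕ) (hterm : IsNextTerm alg s (x.server s).currentTerm t) :
      LocalStep alg x s
        { x.server s with
          role := .candidate
          currentTerm := t
          votedFor := voteFor alg none s
          votes := {s}
          entries := voteEntries alg (x.server s).log (x.server s).commitIndex }
  | becomeLeader (log' : List (Entry Op)) (hrole : (x.server s).role = .candidate)
      (hvotes : IsMajority (x.server s).votes) (hlog : IsLeaderLog alg (x.server s) log') :
      LocalStep alg x s
        { x.server s with
          role := .leader
          log := log'
          votes := ∅
          entries := ∅
          nextIndex := fun _ => initialNextIndex alg (x.server s)
          matchIndex := fun _ => 0 }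
  | clientRequest (op : Op) (hrole : (x.server s).role = .leader) :
      LocalStep alg x s
        { x.server s with
          log := (x.server s).log ++ [{ op := op, term := (x.server s).currentTerm }] }
  | advanceCommit (N : ℕ) (hrole : (x.server s).role = .leader)
      (hN : (x.server s).commitIndex < N) (hlen : N ≤ (x.server s).log.length)
      (hmaj : IsMajority (Finset.univ.filter fun j => j = s ∨ N ≤ (x.server s).matchIndex j))
      (hcommit : MayCommit alg (x.server s) N) :
      LocalStep alg x s { x.server s with commitIndex := N }
  | restart :
      LocalStep alg x s
        { Server.init n Op with
          currentTerm := (x.server s).currentTerm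
          votedFor := (x.server s).votedFor
          log := (x.server s).log }
  | learnTerm (t : ℕ) (hterm : (x.server s).currentTerm < t) :
      LocalStep alg x s
        { x.server s with
          role := .follower
          currentTerm := t
          votedFor := none }
  | receiveVote (v : Fin n) (a : VoteArgs) (T : ℕ) (E : Set (ℕ × Entry Op))
      (hm : .voteReply v s a T true E ∈ x.network) (hrole : (x.server s).role = .candidate)
      (ha : a.term = (x.server s).currentTerm) (hT : T = (x.server s).currentTerm) :
      LocalStep alg x s
        { x.server s with
          votes := insert v (x.server s).votes
          entries := (x.server s).entries ∪ E }
  | acceptAppend (l : Fin n) (a : AppendArgs Op) (hm : .appendRequest l s a ∈ x.network)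
      (hterm : a.term = (x.server s).currentTerm) (hprev : PrevMatches (x.server s).log a) :
      LocalStep alg x s
        { x.server s with
          role := roleOnAppend alg (x.server s).role
          log := storeEntries (x.server s).log a.prevLogIndex a.entries
          commitIndex := max (x.server s).commitIndex
            (min a.leaderCommit (a.prevLogIndex + a.entries.length)) }
  | appendSucceeded (j : Fin n) (a : AppendArgs Op) (T : ℕ)
      (hm : .appendReply j s a T true ∈ x.network) (hrole : (x.server s).role = .leader)
      (ha : a.term = (x.server s).currentTerm) (hT : T = (x.server s).currentTerm) :
      LocalStep alg x s
        { x.server s with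
          nextIndex := Function.update (x.server s).nextIndex j
            (a.prevLogIndex + a.entries.length + 1)
          matchIndex := Function.update (x.server s).matchIndex j
            (max ((x.server s).matchIndex j) (a.prevLogIndex + a.entries.length)) }

section Steps

variable {n : ℕ} {Op : Type*} {alg : Algorithm} {x y : State n Op}

theorem LocalStep.refl (alg : Algorithm) (x : State n Op) (s : Fin n) :
    LocalStep alg x s (x.server s) :=
  .quiet _ (.inl rfl) rfl (fun _ _ h => h) rfl rfl rfl rfl rfl

theorem LocalStep.update {s : Fin n} {v : Server n Op} {out : Set (Message n Op)}
    (h : LocalStep alg x s v) (s' : Fin n) :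
    LocalStep alg x s' ((x.update s v out).server s') := by
  by_cases hs : s' = s
  · subst hs
    simpa [State.update] using h
  · simpa [State.update, hs] using LocalStep.refl alg x s'

theorem roleOnAppend_eq (alg : Algorithm) (r : Role) :
    roleOnAppend alg r = r ∨ roleOnAppend alg r = .follower := by
  cases alg <;> cases r <;> simp [roleOnAppend]

theorem Step.localStep (h : Step alg x y) (s : Fin n) : LocalStep alg x s (y.server s) := by
  cases h with
  | timeout s' t hrole hterm => exact (LocalStep.timeout t hterm).update s
  | becomeLeader s' log' hrole hvotes hlog =>
    exact (LocalStep.becomeLeader log' hrole hvotes hlog).update s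
  | clientRequest s' op hrole => exact (LocalStep.clientRequest op hrole).update s
  | heartbeat s' j hrole hj => exact (LocalStep.refl alg x s').update s
  | replicate s' j es hrole hj hnext hes => exact (LocalStep.refl alg x s').update s
  | advanceCommit s' N hrole hN hlen hmaj hcommit =>
    exact (LocalStep.advanceCommit N hrole hN hlen hmaj hcommit).update s
  | apply s' h =>
    apply LocalStep.update
    exact .quiet _ (.inl rfl) rfl (fun _ _ h => h) rfl rfl rfl rfl rfl
  | restart s' => exact LocalStep.restart.update s
  | learnTerm m hm hterm => exact (LocalStep.learnTerm _ hterm).update s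
  | denyVote c s' a hm h => exact (LocalStep.refl alg x s').update s
  | grantVote c s' a hm hterm hvote =>
    apply LocalStep.update
    refine .quiet _ (.inl rfl) rfl ?_ rfl rfl rfl rfl rfl
    rintro d rfl hd
    rcases hvote.1 with h | h
    · rw [h] at hd
      cases hd
    · rw [← hd, h]
      rfl
  | receiveVote v s' a T E hm hrole ha hT =>
    exact (LocalStep.receiveVote v a T E hm hrole ha hT).update s
  | refuseAppend l s' a hm hterm => exact (LocalStep.refl alg x s').update s
  | mismatchAppend l s' a hm hterm hprev =>
    apply LocalStep.update
    exact .quiet _ (roleOnAppend_eq _ _) rfl (fun _ _ h => h) rfl rfl rfl rfl rfl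
  | acceptAppend l s' a hm hterm hprev =>
    exact (LocalStep.acceptAppend l a hm hterm hprev).update s
  | appendSucceeded j s' a T hm hrole ha hT =>
    exact (LocalStep.appendSucceeded j a T hm hrole ha hT).update s
  | appendFailed j s' a T hm hrole ha hT =>
    apply LocalStep.update
    exact .quiet _ (.inl rfl) rfl (fun _ _ h => h) rfl rfl rfl rfl rfl

/-- The circumstances in which a message is sent in a step from `x` to `y`. -/
def Sent (alg : Algorithm) (x y : State n Op) : Message n Op → Prop
  | .voteRequest s _ a =>
      (y.server s).role = .candidate ∧ (y.server s).currentTerm = a.term ∧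
      a.leaderCommit = (y.server s).commitIndex ∧ a.lastLogIndex = (y.server s).log.length ∧
      a.lastLogTerm = termAt (y.server s).log (y.server s).log.length
  | .voteReply s c a T true E =>
      .voteRequest c s a ∈ x.network ∧ a.term = T ∧ (y.server s).currentTerm = T ∧
      MayVote alg (x.server s) c a ∧ (y.server s).log = (x.server s).log ∧
      (y.server s).votedFor = voteFor alg (x.server s).votedFor c ∧
      E = voteEntries alg (x.server s).log a.leaderCommit
  | .appendRequest l j a =>
      l ≠ j ∧ IsLeaderOf x l a.term ∧ ∃ es, a = appendArgs (x.server l) j es ∧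
        (es = [] ∨ MaySend alg ((x.server l).log.drop ((x.server l).nextIndex j - 1)) es)
  | .appendReply s l a T true =>
      .appendRequest l s a ∈ x.network ∧ a.term = T ∧ (x.server s).currentTerm = T ∧
      (y.server s).currentTerm = T ∧ PrevMatches (x.server s).log a ∧
      (y.server s).log = storeEntries (x.server s).log a.prevLogIndex a.entries
  | _ => True

theorem Step.sent (h : Step alg x y) {m : Message n Op} (hm : m ∈ y.network) :
    m ∈ x.network ∨ Sent alg x y m := by
  cases h with
  | timeout s' t hrole hterm =>
    refine hm.imp_right ?_
    rintro ⟨j, hj, rfl⟩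
    simp [Sent, State.update]
  | becomeLeader s' log' hrole hvotes hlog => exact hm.imp_right fun h => h.elim
  | clientRequest s' op hrole => exact hm.imp_right fun h => h.elim
  | heartbeat s' j hrole hj =>
    refine hm.imp_right ?_
    rintro rfl
    exact ⟨hj.symm, ⟨hrole, rfl⟩, [], rfl, .inl rfl⟩
  | replicate s' j es hrole hj hnext hes =>
    refine hm.imp_right ?_
    rintro rfl
    exact ⟨hj.symm, ⟨hrole, rfl⟩, es, rfl, .inr hes⟩
  | advanceCommit s' N hrole hN hlen hmaj hcommit => exact hm.imp_right fun h => h.elim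
  | apply s' h => exact hm.imp_right fun h => h.elim
  | restart s' => exact hm.imp_right fun h => h.elim
  | learnTerm m hm' hterm => exact hm.imp_right fun h => h.elim
  | denyVote c s' a hm' h =>
    refine hm.imp_right ?_
    rintro rfl
    trivial
  | grantVote c s' a hm' hterm hvote =>
    refine hm.imp_right ?_
    rintro rfl
    simp [Sent, State.update, hm', hterm, hvote]
  | receiveVote v s' a T E hm' hrole ha hT => exact hm.imp_right fun h => h.elim
  | refuseAppend l s' a hm' hterm =>
    refine hm.imp_right ?_
    rintro rfl
    trivial
  | mismatchAppend l s' a hm' hterm hprev =>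
    refine hm.imp_right ?_
    rintro rfl
    trivial
  | acceptAppend l s' a hm' hterm hprev =>
    refine hm.imp_right ?_
    rintro rfl
    simp [Sent, State.update, hm', hterm, hprev]
  | appendSucceeded j s' a T hm' hrole ha hT => exact hm.imp_right fun h => h.elim
  | appendFailed j s' a T hm' hrole ha hT => exact hm.imp_right fun h => h.elim

end Steps

/-! ### Roles, terms and votes across one step. -/

section Roles

variable {n : ℕ} {Op : Type*} {alg : Algorithm} {x : State n Op} {s : Fin n} {v : Server n Op}

theorem IsNextTerm.lt {cur t : ℕ} (h : IsNextTerm alg s cur t) : cur < t := by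
  cases alg
  · exact h.1.1
  · have : t = cur + 1 := h
    omega

theorem roleOnAppend_eq_leader {r : Role} (h : roleOnAppend alg r = .leader) : r = .leader := by
  cases alg <;> cases r <;> simp_all [roleOnAppend]

theorem roleOnAppend_eq_candidate {r : Role} (h : roleOnAppend alg r = .candidate) :
    alg = .paxos ∧ r = .candidate := by
  cases alg <;> cases r <;> simp_all [roleOnAppend]

theorem LocalStep.term_le (h : LocalStep alg x s v) :
    (x.server s).currentTerm ≤ v.currentTerm := by
  cases h with
  | quiet v hrole hterm => exact hterm.ge
  | timeout t hterm => exact hterm.lt.le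
  | learnTerm t hterm => exact hterm.le
  | _ => exact le_rfl

/-- Candidacy begins only with a timeout, which raises the term. -/
theorem LocalStep.candidate_before (h : LocalStep alg x s v)
    (hT : v.currentTerm = (x.server s).currentTerm) (hv : v.role = .candidate) :
    (x.server s).role = .candidate := by
  cases h with
  | quiet v hrole hterm =>
    rcases hrole with h | h
    · rw [← h, hv]
    · simp [h] at hv
  | timeout t hterm => exact absurd hT hterm.lt.ne'
  | acceptAppend l a hm hterm hprev => exact (roleOnAppend_eq_candidate hv).2
  | becomeLeader | restart | learnTerm => cases hv
  | _ => exact hv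

/-- This splits each invariant about leaders into two cases: staying leader, and being elected. -/
theorem LocalStep.leader_before (h : LocalStep alg x s v) (hv : v.role = .leader) :
    v.currentTerm = (x.server s).currentTerm ∧ ((x.server s).role = .leader ∨
      ((x.server s).role = .candidate ∧ IsMajority (x.server s).votes ∧
        IsLeaderLog alg (x.server s) v.log ∧ v.commitIndex = (x.server s).commitIndex ∧
        v.matchIndex = fun _ => 0)) := by
  cases h with
  | quiet v hrole hterm =>
    rcases hrole with h | h
    · exact ⟨hterm, .inl (by rw [← h, hv])⟩
    · simp [h] at hv
  | becomeLeader log' hrole hvotes hlog => exact ⟨rfl, .inr ⟨hrole, hvotes, hlog, rfl, rfl⟩⟩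
  | acceptAppend l a hm hterm hprev => exact ⟨rfl, .inl (roleOnAppend_eq_leader hv)⟩
  | timeout | restart | learnTerm => cases hv
  | _ => exact ⟨rfl, .inl hv⟩

/-- Only steps that raise the term erase a vote; a restart preserves it. -/
theorem LocalStep.votedFor_eq (h : LocalStep .raft x s v)
    (hT : v.currentTerm = (x.server s).currentTerm) {c : Fin n}
    (hc : (x.server s).votedFor = some c) : v.votedFor = some c := by
  cases h with
  | quiet v hrole hterm hvote => exact hvote c rfl hc
  | timeout t hterm => exact absurd hT hterm.lt.ne'
  | learnTerm t hterm => exact absurd hT hterm.ne'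
  | _ => exact hc

theorem LocalStep.term_pos (h : LocalStep alg x s v)
    (ih : (x.server s).role ≠ .follower → 0 < (x.server s).currentTerm)
    (hv : v.role ≠ .follower) : 0 < v.currentTerm := by
  cases h with
  | quiet v hrole hterm =>
    rw [hterm]
    exact ih fun h => hv (by simpa [h] using hrole)
  | timeout t hterm => exact Nat.zero_lt_of_lt hterm.lt
  | acceptAppend l a hm hterm hprev =>
    refine ih fun h => hv ?_
    simpa [h] using roleOnAppend_eq alg (x.server s).role
  | becomeLeader log' hrole => exact ih (by simp [hrole])
  | restart | learnTerm => exact absurd rfl hv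
  | _ => exact ih hv

/-- Only a timeout makes a follower something else, and it picks a term in the server's own residue
class; a term learned from a message comes with the role of follower. -/
theorem LocalStep.term_mod (h : LocalStep .paxos x s v)
    (ih : (x.server s).role ≠ .follower → (x.server s).currentTerm % n = s)
    (hv : v.role ≠ .follower) : v.currentTerm % n = s := by
  cases h with
  | quiet v hrole hterm =>
    rw [hterm]
    exact ih fun h => hv (by simpa [h] using hrole)
  | timeout t hterm => exact hterm.1.2
  | acceptAppend l a hm hterm hprev =>
    refine ih fun h => hv ?_
    simpa [h] using roleOnAppend_eq .paxos (x.server s).role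
  | becomeLeader log' hrole => exact ih (by simp [hrole])
  | restart | learnTerm => exact absurd rfl hv
  | _ => exact ih hv

end Roles

/-! ### Executions, votes and election safety. -/

section Executions

variable {n : ℕ} {Op : Type*} {alg : Algorithm} {σ : ℕ → State n Op}

theorem IsExecution.localStep (hσ : IsExecution alg σ) (k : ℕ) (s : Fin n) :
    LocalStep alg (σ k) s ((σ (k + 1)).server s) := by
  rcases hσ.2 k with h | h
  · rw [h]
    exact .refl alg (σ k) s
  · exact h.localStep s

theorem IsExecution.init (hσ : IsExecution alg σ) (s : Fin n) :
    (σ 0).server s = Server.init n Op := by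
  rw [hσ.1]
  rfl

/-- Tracing a message to a strictly earlier step makes the sender's state accessible to induction on
time. -/
theorem IsExecution.sent (hσ : IsExecution alg σ) {k : ℕ} {m : Message n Op}
    (hm : m ∈ (σ k).network) : ∃ k' < k, Sent alg (σ k') (σ (k' + 1)) m := by
  induction k with
  | zero =>
    rw [hσ.1] at hm
    exact hm.elim
  | succ k ih =>
    have : m ∈ (σ k).network ∨ Sent alg (σ k) (σ (k + 1)) m := by
      rcases hσ.2 k with h | h
      · rw [h] at hm
        exact .inl hm
      · exact h.sent hm
    rcases this with h | h
    · obtain ⟨k', hk', h'⟩ := ih h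
      exact ⟨k', by omega, h'⟩
    · exact ⟨k, by omega, h⟩

theorem IsExecution.term_mono (hσ : IsExecution alg σ) (s : Fin n) :
    Monotone fun k => ((σ k).server s).currentTerm :=
  monotone_nat_of_le_succ fun k => (hσ.localStep k s).term_le

theorem IsExecution.term_pos (hσ : IsExecution alg σ) {k : ℕ} {s : Fin n}
    (h : ((σ k).server s).role ≠ .follower) : 0 < ((σ k).server s).currentTerm := by
  induction k with
  | zero => exact absurd (by rw [hσ.init]; rfl) h
  | succ k ih => exact (hσ.localStep k s).term_pos ih h

theorem IsExecution.term_mod (hσ : IsExecution .paxos σ) {k : ℕ} {s : Fin n}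
    (h : ((σ k).server s).role ≠ .follower) : ((σ k).server s).currentTerm % n = s := by
  induction k with
  | zero => exact absurd (by rw [hσ.init]; rfl) h
  | succ k ih => exact (hσ.localStep k s).term_mod ih h

theorem IsExecution.candidate_before (hσ : IsExecution alg σ) {k k' : ℕ} {s : Fin n}
    (hk : k ≤ k') (hT : ((σ k').server s).currentTerm = ((σ k).server s).currentTerm)
    (h : ((σ k').server s).role = .candidate) : ((σ k).server s).role = .candidate := by
  induction k', hk using Nat.le_induction with
  | base => exact h
  | succ m hm ih =>
    have h1 := hσ.term_mono s hm
    have h2 := hσ.term_mono s (Nat.le_add_right m 1)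
    dsimp only at h1 h2
    exact ih (by omega) ((hσ.localStep m s).candidate_before (by omega) h)

theorem IsExecution.votedFor_eq (hσ : IsExecution .raft σ) {k k' : ℕ} {s c : Fin n}
    (hk : k ≤ k') (hT : ((σ k').server s).currentTerm = ((σ k).server s).currentTerm)
    (h : ((σ k).server s).votedFor = some c) : ((σ k').server s).votedFor = some c := by
  induction k', hk using Nat.le_induction with
  | base => exact h
  | succ m hm ih =>
    have h1 := hσ.term_mono s hm
    have h2 := hσ.term_mono s (Nat.le_add_right m 1)
    dsimp only at h1 h2
    exact (hσ.localStep m s).votedFor_eq (by omega) (ih (by omega))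

/-- Every leader has been elected. -/
theorem IsExecution.elected (hσ : IsExecution alg σ) {k t : ℕ} {s : Fin n}
    (h : IsLeaderOf (σ k) s t) : ∃ k' < k, ((σ k').server s).role = .candidate ∧
      ((σ k').server s).currentTerm = t ∧ IsMajority ((σ k').server s).votes := by
  induction k with
  | zero =>
    have := h.1
    rw [hσ.init] at this
    cases this
  | succ k ih =>
    obtain ⟨hT, h' | h'⟩ := (hσ.localStep k s).leader_before h.1
    · obtain ⟨k', hk', h''⟩ := ih ⟨h', hT ▸ h.2⟩
      exact ⟨k', by omega, h''⟩
    · exact ⟨k, by omega, h'.1, hT ▸ h.2, h'.2.1⟩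

/-- The log and the commit index of a candidate do not change. -/
theorem IsExecution.candidate_step (hσ : IsExecution alg σ) {k : ℕ} {s : Fin n}
    (hT : ((σ (k + 1)).server s).currentTerm = ((σ k).server s).currentTerm)
    (h : ((σ (k + 1)).server s).role = .candidate) :
    ((σ (k + 1)).server s).log = ((σ k).server s).log ∧
      ((σ (k + 1)).server s).commitIndex = ((σ k).server s).commitIndex := by
  have hl := hσ.localStep k s
  have hc := hl.candidate_before hT h
  generalize (σ (k + 1)).server s = v at hl hT h
  cases hl with
  | quiet v hrole hterm hvote hlog hcommit => exact ⟨hlog, hcommit⟩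
  | acceptAppend l a hm hterm hprev =>
    -- Only in Paxos does the candidate remain one here. The sender led the same term, so it has the
    -- same residue modulo `n` and is the candidate itself; but no request goes to its own sender.
    obtain ⟨rfl, -⟩ := roleOnAppend_eq_candidate h
    obtain ⟨k', -, hne, hlead, -⟩ := hσ.sent hm
    have h1 := hσ.term_mod (k := k') (s := l) (by rw [hlead.1]; simp)
    have h2 := hσ.term_mod (k := k) (s := s) (by rw [hc]; simp)
    rw [hlead.2, hterm, h2] at h1
    exact absurd (Fin.ext h1.symm) hne
  | timeout t hterm => exact absurd hT hterm.lt.ne'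
  | advanceCommit N hrole | clientRequest op hrole => simp [hrole] at hc
  | becomeLeader | restart | learnTerm => cases h
  | _ => exact ⟨rfl, rfl⟩

theorem IsExecution.candidate_log (hσ : IsExecution alg σ) {k k' : ℕ} {s : Fin n}
    (hk : k ≤ k') (hT : ((σ k').server s).currentTerm = ((σ k).server s).currentTerm)
    (h : ((σ k').server s).role = .candidate) :
    ((σ k').server s).log = ((σ k).server s).log ∧
      ((σ k').server s).commitIndex = ((σ k).server s).commitIndex := by
  induction k', hk using Nat.le_induction with
  | base => exact ⟨rfl, rfl⟩
  | succ m hm ih =>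
    have h1 := hσ.term_mono s hm
    have h2 := hσ.term_mono s (Nat.le_add_right m 1)
    dsimp only at h1 h2
    have h3 := hσ.candidate_step (by omega) h
    have h4 := ih (by omega) ((hσ.localStep m s).candidate_before (by omega) h)
    exact ⟨h3.1.trans h4.1, h3.2.trans h4.2⟩

/-- A vote request comes from a server that was a candidate at some earlier time; when it is a
candidate of the term of the request, the request describes its log and its commit index. -/
theorem IsExecution.voteRequest_args (hσ : IsExecution alg σ) {k k' : ℕ} {s j : Fin n}
    {a : VoteArgs} (hm : .voteRequest s j a ∈ (σ k').network) (hk : k' ≤ k)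
    (h : ((σ k).server s).role = .candidate) (hT : a.term = ((σ k).server s).currentTerm) :
    a.leaderCommit = ((σ k).server s).commitIndex ∧
      a.lastLogIndex = ((σ k).server s).log.length ∧
      a.lastLogTerm = termAt ((σ k).server s).log ((σ k).server s).log.length := by
  obtain ⟨m, hm, hrole, hterm, h1, h2, h3⟩ := hσ.sent hm
  obtain ⟨hl, hc⟩ := hσ.candidate_log (k := m + 1) (k' := k) (s := s) (by omega)
    (by rw [hterm, hT]) h
  rw [hl, hc]
  exact ⟨h1, h2, h3⟩

/-- The comparison of logs in a vote of Raft. -/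
def UpToDate (l l' : List (Entry Op)) : Prop :=
  termAt l' l'.length < termAt l l.length ∨
    (termAt l l.length = termAt l' l'.length ∧ l'.length ≤ l.length)

/-- The candidate's log is frozen during its candidacy, so the log that the voter compared is still
the candidate's log when the vote is counted. -/
theorem IsExecution.raft_votes (hσ : IsExecution .raft σ) {k : ℕ} {s v : Fin n}
    (h : ((σ k).server s).role = .candidate) (hv : v ∈ ((σ k).server s).votes) :
    ∃ k' ≤ k, ((σ k').server v).currentTerm = ((σ k).server s).currentTerm ∧
      ((σ k').server v).votedFor = some s ∧
      UpToDate ((σ k).server s).log ((σ k').server v).log := by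
  induction k with
  | zero =>
    rw [hσ.init] at h
    cases h
  | succ k ih =>
    have hl := hσ.localStep k s
    by_cases hT : ((σ (k + 1)).server s).currentTerm = ((σ k).server s).currentTerm
    · have hc := hl.candidate_before hT h
      obtain ⟨hlog, -⟩ := hσ.candidate_step hT h
      rw [hT, hlog]
      by_cases hv' : v ∈ ((σ k).server s).votes
      · obtain ⟨k', hk', h'⟩ := ih hc hv'
        exact ⟨k', by omega, h'⟩
      generalize (σ (k + 1)).server s = w at hl hT h hv
      cases hl with
      | quiet w hrole hterm hvote hlog hcommit hvotes => exact absurd (hvotes ▸ hv) hv'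
      | timeout t hterm => exact absurd hT hterm.lt.ne'
      | becomeLeader | restart | learnTerm => cases h
      | receiveVote w a T E hm hrole ha hT' =>
        obtain rfl : v = w := by
          rcases Finset.mem_insert.1 hv with h | h
          · exact h
          · exact absurd h hv'
        obtain ⟨m, hmk, hreq, haT, hmT, hvote, hmlog, hmvote, -⟩ := hσ.sent hm
        obtain ⟨-, h2, h3⟩ := hσ.voteRequest_args hreq hmk.le hrole ha
        refine ⟨m + 1, by omega, hmT.trans hT', hmvote, ?_⟩
        rw [hmlog, UpToDate, ← h3, ← h2]
        exact hvote.2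
      | _ => exact absurd hv hv'
    -- A candidate whose term has just changed comes from a timeout, and its only vote is its own.
    · generalize hw : (σ (k + 1)).server s = w at hl hT h hv
      cases hl with
      | timeout t hterm =>
        obtain rfl := Finset.mem_singleton.1 hv
        exact ⟨k + 1, le_rfl, by rw [hw], by rw [hw]; rfl, by rw [hw]; exact .inr ⟨rfl, le_rfl⟩⟩
      | quiet w hrole hterm => exact absurd hterm hT
      | learnTerm => cases h
      | _ => exact absurd rfl hT

/-- A vote is a snapshot of the voter's log beyond the commit index in the request, which the
candidate still has; further votes only enlarge `entries`. -/
theorem IsExecution.paxos_votes (hσ : IsExecution .paxos σ) {k : ℕ} {s v : Fin n}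
    (h : ((σ k).server s).role = .candidate) (hv : v ∈ ((σ k).server s).votes) :
    ∃ k' ≤ k, ((σ k').server v).currentTerm = ((σ k).server s).currentTerm ∧
      entriesAfter ((σ k').server v).log ((σ k).server s).commitIndex ⊆
        ((σ k).server s).entries := by
  induction k with
  | zero =>
    rw [hσ.init] at h
    cases h
  | succ k ih =>
    have hl := hσ.localStep k s
    by_cases hT : ((σ (k + 1)).server s).currentTerm = ((σ k).server s).currentTerm
    · have hc := hl.candidate_before hT h
      obtain ⟨-, hcommit⟩ := hσ.candidate_step hT h
      rw [hT, hcommit]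
      have old (hv' : v ∈ ((σ k).server s).votes)
          (hE : ((σ k).server s).entries ⊆ ((σ (k + 1)).server s).entries) :
          ∃ k' ≤ k + 1, ((σ k').server v).currentTerm = ((σ k).server s).currentTerm ∧
            entriesAfter ((σ k').server v).log ((σ k).server s).commitIndex ⊆
              ((σ (k + 1)).server s).entries := by
        obtain ⟨k', hk', h1, h2⟩ := ih hc hv'
        exact ⟨k', by omega, h1, h2.trans hE⟩
      generalize (σ (k + 1)).server s = w at hl hT h hv old
      cases hl with
      | quiet w hrole hterm hvote hlog hcommit hvotes hentries =>
        exact old (hvotes ▸ hv) hentries.ge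
      | timeout t hterm => exact absurd hT hterm.lt.ne'
      | becomeLeader | restart | learnTerm => cases h
      | receiveVote w a T E hm hrole ha hT' =>
        rcases Finset.mem_insert.1 hv with rfl | hv
        · obtain ⟨m, hmk, hreq, haT, hmT, hvote, hmlog, hmvote, rfl⟩ := hσ.sent hm
          obtain ⟨h1, -, -⟩ := hσ.voteRequest_args hreq hmk.le hrole ha
          refine ⟨m + 1, by omega, hmT.trans hT', ?_⟩
          rw [hmlog, ← h1]
          exact Set.subset_union_right
        · exact old hv Set.subset_union_left
      | _ => exact old hv le_rfl
    · generalize hw : (σ (k + 1)).server s = w at hl hT h hv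
      cases hl with
      | timeout t hterm =>
        obtain rfl := Finset.mem_singleton.1 hv
        exact ⟨k + 1, le_rfl, by rw [hw], by rw [hw]; exact le_rfl⟩
      | quiet w hrole hterm => exact absurd hterm hT
      | learnTerm => cases h
      | _ => exact absurd rfl hT

/-- Places each collected entry in an actual log at a time up to `k`, where inductive invariants are
available. -/
theorem IsExecution.paxos_entries (hσ : IsExecution .paxos σ) {k i : ℕ} {s : Fin n}
    {e : Entry Op} (h : ((σ k).server s).role = .candidate)
    (he : (i, e) ∈ ((σ k).server s).entries) :
    ∃ k' ≤ k, ∃ v, ((σ k').server v).currentTerm = ((σ k).server s).currentTerm ∧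
      entryAt ((σ k').server v).log i = some e := by
  induction k with
  | zero =>
    rw [hσ.init] at h
    cases h
  | succ k ih =>
    have hl := hσ.localStep k s
    by_cases hT : ((σ (k + 1)).server s).currentTerm = ((σ k).server s).currentTerm
    · have hc := hl.candidate_before hT h
      rw [hT]
      by_cases he' : (i, e) ∈ ((σ k).server s).entries
      · obtain ⟨k', hk', h'⟩ := ih hc he'
        exact ⟨k', by omega, h'⟩
      generalize (σ (k + 1)).server s = w at hl hT h he
      cases hl with
      | quiet w hrole hterm hvote hlog hcommit hvotes hentries => exact absurd (hentries ▸ he) he'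
      | timeout t hterm => exact absurd hT hterm.lt.ne'
      | becomeLeader | restart | learnTerm => cases h
      | receiveVote w a T E hm hrole ha hT' =>
        obtain ⟨m, hmk, hreq, haT, hmT, hvote, hmlog, hmvote, rfl⟩ := hσ.sent hm
        have he := he.resolve_left he'
        exact ⟨m + 1, by omega, w, hmT.trans hT', by rw [hmlog]; exact he.2⟩
      | _ => exact absurd he he'
    · generalize hw : (σ (k + 1)).server s = w at hl hT h he
      cases hl with
      | timeout t hterm => exact ⟨k + 1, le_rfl, s, by rw [hw], by rw [hw]; exact he.2⟩
      | quiet w hrole hterm => exact absurd hterm hT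
      | learnTerm => cases h
      | _ => exact absurd rfl hT

/-- Election safety. -/
theorem IsExecution.leader_unique (hσ : IsExecution alg σ) {k k' t : ℕ} {s s' : Fin n}
    (h : IsLeaderOf (σ k) s t) (h' : IsLeaderOf (σ k') s' t) : s = s' := by
  cases alg with
  | paxos =>
    have h1 := hσ.term_mod (k := k) (s := s) (by rw [h.1]; simp)
    have h2 := hσ.term_mod (k := k') (s := s') (by rw [h'.1]; simp)
    rw [h.2] at h1
    rw [h'.2, h1] at h2
    exact Fin.ext h2
  | raft =>
    obtain ⟨m, -, hc, hT, hQ⟩ := hσ.elected h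
    obtain ⟨m', -, hc', hT', hQ'⟩ := hσ.elected h'
    -- A common voter `j` still holds its earlier vote of this term when the later one is recorded,
    -- so the two coincide.
    obtain ⟨j, hj, hj'⟩ := exists_mem_of_isMajority hQ hQ'
    obtain ⟨q, -, hq, hqv, -⟩ := hσ.raft_votes hc hj
    obtain ⟨q', -, hq', hqv', -⟩ := hσ.raft_votes hc' hj'
    rcases le_total q q' with hle | hle
    · have := hσ.votedFor_eq hle (by rw [hq, hq', hT, hT']) hqv
      rw [hqv'] at this
      exact (Option.some.inj this).symm
    · have := hσ.votedFor_eq hle (by rw [hq, hq', hT, hT']) hqv'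
      rw [hqv] at this
      exact Option.some.inj this

/-- A candidate has not yet been leader of its term. -/
theorem IsExecution.not_leader_of_candidate (hσ : IsExecution alg σ) {k k' : ℕ} {s : Fin n}
    (h : ((σ k).server s).role = .candidate) (hk : k' ≤ k) :
    ¬ IsLeaderOf (σ k') s ((σ k).server s).currentTerm := by
  intro hl
  have := hσ.candidate_before hk hl.2.symm h
  rw [hl.1] at this
  cases this

/-- In Paxos, a term has no leader as long as it has a candidate. -/
theorem IsExecution.paxos_not_leader_of_candidate (hσ : IsExecution .paxos σ) {k k' : ℕ}
    {s s' : Fin n} (h : ((σ k).server s).role = .candidate) (hk : k' ≤ k) :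
    ¬ IsLeaderOf (σ k') s' ((σ k).server s).currentTerm := by
  intro hl
  have h1 := hσ.term_mod (k := k) (s := s) (by rw [h]; simp)
  have h2 := hσ.term_mod (k := k') (s := s') (by rw [hl.1]; simp)
  rw [hl.2, h1] at h2
  obtain rfl : s = s' := Fin.ext h2
  exact hσ.not_leader_of_candidate h hk hl

end Executions

/-! ### Log matching and replication. -/

section LogMatching

variable {n : ℕ} {Op : Type*} {alg : Algorithm} {σ : ℕ → State n Op}

theorem mem_overwrite {old es : List (Entry Op)} {e : Entry Op} (h : e ∈ overwrite old es) :
    e ∈ old ∨ e ∈ es := by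
  induction es generalizing old with
  | nil => exact .inl (by simpa only [overwrite] using h)
  | cons a es ih =>
    cases old with
    | nil => exact .inr (by simpa [overwrite] using h)
    | cons o os =>
      simp only [overwrite] at h
      split_ifs at h
      · rcases List.mem_cons.1 h with rfl | h
        · simp
        · exact (ih h).imp (List.mem_cons_of_mem _) (List.mem_cons_of_mem _)
      · exact .inr h

theorem mem_storeEntries {old es : List (Entry Op)} {p : ℕ} {e : Entry Op}
    (h : e ∈ storeEntries old p es) : e ∈ old ∨ e ∈ es := by
  rcases List.mem_append.1 h with h | h
  · exact .inl (List.mem_of_mem_take h)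
  · exact (mem_overwrite h).imp_left List.mem_of_mem_drop

/-- The Paxos merge keeps the log up to the commit index and gives everything beyond it the new
term. -/
theorem IsLeaderLog.take_eq_or {v : Server n Op} {log' : List (Entry Op)}
    (h : IsLeaderLog alg v log') {i : ℕ} {e : Entry Op} (he : entryAt log' i = some e) :
    log'.take i = v.log.take i ∨ e.term = v.currentTerm := by
  cases alg with
  | raft =>
    obtain rfl : log' = v.log := h
    exact .inl rfl
  | paxos =>
    rcases le_or_gt i v.commitIndex with hi | hi
    · left
      have := congrArg (List.take i) h.1
      simpa [List.take_take, hi] using this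
    · right
      have := h.2 i hi
      rw [he] at this
      exact this.1

theorem IsExecution.appendRequest_args (hσ : IsExecution alg σ) {k : ℕ} {l s : Fin n}
    {a : AppendArgs Op} (hm : .appendRequest l s a ∈ (σ k).network) :
    ∃ k' < k, l ≠ s ∧ IsLeaderOf (σ k') l a.term ∧
      a.prevLogTerm = termAt ((σ k').server l).log a.prevLogIndex ∧
      a.leaderCommit = ((σ k').server l).commitIndex ∧
      a.entries <+: ((σ k').server l).log.drop a.prevLogIndex ∧
      (alg = .paxos → a.entries = [] ∨
        a.entries = ((σ k').server l).log.drop a.prevLogIndex) := by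
  obtain ⟨k', hk', hne, hl, es, rfl, hes⟩ := hσ.sent hm
  refine ⟨k', hk', hne, hl, rfl, rfl, ?_, ?_⟩
  · rcases hes with rfl | hes
    · exact List.nil_prefix
    · cases alg with
      | paxos => rw [show es = _ from hes]; exact List.prefix_rfl
      | raft => exact hes.1
  · rintro rfl
    exact hes

/-- The only danger is accepting a request of the leader's own term. By election safety its sender
would be this leader, which sends no requests to itself. -/
theorem IsExecution.leader_log_step (hσ : IsExecution alg σ) {k : ℕ} {s : Fin n}
    (h : ((σ k).server s).role = .leader) (h' : ((σ (k + 1)).server s).role = .leader) :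
    ((σ k).server s).log <+: ((σ (k + 1)).server s).log := by
  have hl := hσ.localStep k s
  generalize (σ (k + 1)).server s = v at hl h'
  cases hl with
  | quiet v hrole hterm hvote hlog => rw [hlog]
  | becomeLeader log' hrole => simp [h] at hrole
  | clientRequest op hrole => exact List.prefix_append _ _
  | acceptAppend l a hm hterm hprev =>
    obtain ⟨k', -, hne, hl, -⟩ := hσ.appendRequest_args hm
    exact absurd (hσ.leader_unique hl ⟨h, hterm.symm⟩) hne
  | _ => exact List.prefix_rfl

/-- A candidate has never led its term, so no second election interrupts the growth. -/
theorem IsExecution.leader_log_mono (hσ : IsExecution alg σ) {k k' t : ℕ} {s s' : Fin n}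
    (hk : k ≤ k') (h : IsLeaderOf (σ k) s t) (h' : IsLeaderOf (σ k') s' t) :
    ((σ k).server s).log <+: ((σ k').server s').log := by
  obtain rfl := hσ.leader_unique h h'
  induction k', hk using Nat.le_induction with
  | base => exact List.prefix_rfl
  | succ m hm ih =>
    obtain ⟨hT, hr⟩ := (hσ.localStep m s).leader_before h'.1
    have hT' : ((σ m).server s).currentTerm = t := hT ▸ h'.2
    rcases hr with hr | ⟨hr, -⟩
    · exact (ih ⟨hr, hT'⟩).trans (hσ.leader_log_step hr h'.1)
    · exact absurd (hT' ▸ h) (hσ.not_leader_of_candidate hr hm)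

theorem IsExecution.leader_log_total (hσ : IsExecution alg σ) {k k' t : ℕ} {s s' : Fin n}
    (h : IsLeaderOf (σ k) s t) (h' : IsLeaderOf (σ k') s' t) :
    ((σ k).server s).log <+: ((σ k').server s').log ∨
      ((σ k').server s').log <+: ((σ k).server s).log :=
  (le_total k k').imp (fun hk => hσ.leader_log_mono hk h h') fun hk => hσ.leader_log_mono hk h' h

/-- Two prefixes of logs of leaders of the same term are comparable. -/
theorem IsExecution.prefix_total (hσ : IsExecution alg σ) {k k' t : ℕ} {s s' : Fin n}
    (h : IsLeaderOf (σ k) s t) (h' : IsLeaderOf (σ k') s' t) {p q : List (Entry Op)}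
    (hp : p <+: ((σ k).server s).log) (hq : q <+: ((σ k').server s').log) :
    p <+: q ∨ q <+: p := by
  rcases hσ.leader_log_total h h' with hle | hle
  · exact Consensus.prefix_total (hp.trans hle) hq
  · exact Consensus.prefix_total hp (hq.trans hle)

/-- Entries received from elsewhere were in the log of a leader of the receiver's current term at an
earlier time; hence the strong induction. -/
theorem IsExecution.entry_term_le (hσ : IsExecution alg σ) {k : ℕ} {s : Fin n} {e : Entry Op}
    (he : e ∈ ((σ k).server s).log) : e.term ≤ ((σ k).server s).currentTerm := by
  induction k using Nat.strong_induction_on generalizing s with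
  | _ k ih =>
    cases k with
    | zero =>
      rw [hσ.init] at he
      cases he
    | succ k =>
      have ih' := fun he => ih k (by omega) (s := s) he
      have hl := hσ.localStep k s
      generalize (σ (k + 1)).server s = v at hl he
      cases hl with
      | quiet v hrole hterm hvote hlog =>
        rw [hterm]
        exact ih' (hlog ▸ he)
      | timeout t hterm => exact (ih' he).trans hterm.lt.le
      | learnTerm t hterm => exact (ih' he).trans hterm.le
      | becomeLeader log' hrole hvotes hlog =>
        obtain ⟨i, hi⟩ := exists_entryAt_of_mem he
        rcases hlog.take_eq_or hi with h | h
        · rw [entryAt_eq_of_take_eq h le_rfl] at hi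
          exact ih' (mem_of_entryAt hi)
        · exact h.le
      | clientRequest op hrole =>
        rcases List.mem_append.1 he with h | h
        · exact ih' h
        · rw [List.mem_singleton.1 h]
      | acceptAppend l a hm hterm hprev =>
        rcases mem_storeEntries he with h | h
        · exact ih' h
        · obtain ⟨k', hk', -, hl, -, -, hes, -⟩ := hσ.appendRequest_args hm
          have := ih k' (by omega) (s := l) (List.mem_of_mem_drop (hes.subset h))
          rw [hl.2, hterm] at this
          exact this
      | _ => exact ih' he

/-- Each initial part of the list `l` is an initial part of the log that the leader of the term
of its last entry had at some time up to `k`. -/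
def FromLeaders (σ : ℕ → State n Op) (k : ℕ) (l : List (Entry Op)) : Prop :=
  ∀ i e, entryAt l i = some e → ∃ k' ≤ k, ∃ s, IsLeaderOf (σ k') s e.term ∧
    l.take i <+: ((σ k').server s).log

theorem FromLeaders.mono {k k' : ℕ} {l : List (Entry Op)} (h : FromLeaders σ k l) (hk : k ≤ k') :
    FromLeaders σ k' l := fun i e he =>
  let ⟨m, hm, h'⟩ := h i e he
  ⟨m, hm.trans hk, h'⟩

theorem FromLeaders.of_isPrefix {k : ℕ} {l l' : List (Entry Op)} (h : FromLeaders σ k l)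
    (hl : l' <+: l) : FromLeaders σ k l' := by
  intro i e he
  obtain ⟨m, hm, s, hs, h'⟩ := h i e (entryAt_of_isPrefix hl he)
  exact ⟨m, hm, s, hs, (hl.take i).trans h'⟩

/-- Both initial parts are prefixes of logs of the one leader of the common term, so they are
comparable, and their lengths are equal. -/
theorem FromLeaders.agree (hσ : IsExecution alg σ) {k k' : ℕ} {l l' : List (Entry Op)}
    (h : FromLeaders σ k l) (h' : FromLeaders σ k' l') : Agree l l' := by
  intro i e f he hf hef
  obtain ⟨m, -, s, hs, hp⟩ := h i e he
  obtain ⟨m', -, s', hs', hp'⟩ := h' i f hf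
  have hlen : (l.take i).length = (l'.take i).length := by
    rw [List.length_take_of_le (entryAt_bounds he).2, List.length_take_of_le (entryAt_bounds hf).2]
  rcases hσ.prefix_total hs (hef ▸ hs') hp hp' with hle | hle
  · exact hle.eq_of_length hlen
  · exact (hle.eq_of_length hlen.symm).symm

theorem FromLeaders.term_pos (hσ : IsExecution alg σ) {k : ℕ} {l : List (Entry Op)}
    (h : FromLeaders σ k l) {e : Entry Op} (he : e ∈ l) : 0 < e.term := by
  obtain ⟨i, hi⟩ := exists_entryAt_of_mem he
  obtain ⟨m, -, s, hs, -⟩ := h i e hi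
  rw [← hs.2]
  exact hσ.term_pos (by rw [hs.1]; simp)

/-- The effect of an accepted request, for logs that match. -/
theorem IsExecution.accept_of_fromLeaders (hσ : IsExecution alg σ) {k : ℕ} {l s : Fin n}
    {a : AppendArgs Op} (hm : .appendRequest l s a ∈ (σ k).network)
    (hprev : PrevMatches ((σ k).server s).log a)
    (hlog : ∀ k' ≤ k, ∀ s', FromLeaders σ k ((σ k').server s').log) :
    ∃ k' < k, ∃ M, IsLeaderOf (σ k') l a.term ∧ M <+: ((σ k').server l).log ∧
      M.length = a.prevLogIndex + a.entries.length ∧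
      a.leaderCommit = ((σ k').server l).commitIndex ∧
      (alg = .paxos → M <+: ((σ k).server s).log ∨ M = ((σ k').server l).log) ∧
      ((M <+: ((σ k).server s).log ∧
          storeEntries ((σ k).server s).log a.prevLogIndex a.entries = ((σ k).server s).log) ∨
        (¬ M <+: ((σ k).server s).log ∧
          storeEntries ((σ k).server s).log a.prevLogIndex a.entries = M)) := by
  obtain ⟨k', hk', -, hl, hpt, hc, hes, hpaxos⟩ := hσ.appendRequest_args hm
  have hs := hlog k le_rfl s
  have hprev' := hprev
  unfold PrevMatches at hprev'
  rw [hpt] at hprev'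
  obtain ⟨M, hM, hMl, hMeq, htake, h⟩ := storeEntries_eq
    (hs.agree hσ (hlog k' hk'.le l)) (fun e he => hs.term_pos hσ he) hes hprev'
  refine ⟨k', hk', M, hl, hM, hMl, hc, fun halg => ?_, h⟩
  rcases hpaxos halg with h0 | h0
  · left
    rw [hMeq, h0, List.append_nil]
    exact htake
  · right
    rw [hMeq, h0, List.take_append_drop]

/-- Log matching. -/
theorem IsExecution.fromLeaders (hσ : IsExecution alg σ) (k : ℕ) (s : Fin n) :
    FromLeaders σ k ((σ k).server s).log := by
  induction k using Nat.strong_induction_on generalizing s with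
  | _ k ih =>
    cases k with
    | zero =>
      rw [hσ.init]
      intro i e he
      simp [Server.init, entryAt] at he
    | succ k =>
      have ih' := (ih k (by omega) s).mono (Nat.le_add_right k 1)
      have hl := hσ.localStep k s
      generalize hv : (σ (k + 1)).server s = v at hl
      cases hl with
      | quiet v hrole hterm hvote hlog => rwa [hlog]
      | becomeLeader log' hrole hvotes hlog =>
        intro i e he
        rcases hlog.take_eq_or he with h | h
        · rw [entryAt_eq_of_take_eq h le_rfl] at he
          obtain ⟨m, hm, s', hs', h'⟩ := ih' i e he
          exact ⟨m, hm, s', hs', by rw [← h] at h'; exact h'⟩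
        -- An entry with the new term is witnessed by the new leader itself, at time `k + 1`.
        · exact ⟨k + 1, le_rfl, s, ⟨by rw [hv], by rw [hv, h]⟩, by
            rw [hv]; exact List.take_prefix _ _⟩
      | clientRequest op hrole =>
        intro i e he
        rcases entryAt_concat he with h | ⟨-, rfl⟩
        · obtain ⟨m, hm, s', hs', h'⟩ := ih' i e h
          refine ⟨m, hm, s', hs', ?_⟩
          dsimp only
          rwa [List.take_append_of_le_length (entryAt_bounds h).2]
        · exact ⟨k + 1, le_rfl, s, ⟨by rw [hv]; exact hrole, by rw [hv]⟩, by
            rw [hv]; exact List.take_prefix _ _⟩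
      | acceptAppend l a hm hterm hprev =>
        obtain ⟨k', hk', M, -, hM, -, -, -, h⟩ := hσ.accept_of_fromLeaders hm hprev
          fun k' hk' s' => (ih k' (by omega) s').mono hk'
        dsimp only
        rcases h with ⟨-, h⟩ | ⟨-, h⟩
        · rwa [h]
        · rw [h]
          exact ((ih k' (by omega) l).mono (by omega)).of_isPrefix hM
      | _ => exact ih'

theorem IsExecution.agree (hσ : IsExecution alg σ) (k k' : ℕ) (s s' : Fin n) :
    Agree ((σ k).server s).log ((σ k').server s').log :=
  (hσ.fromLeaders k s).agree hσ (hσ.fromLeaders k' s')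

theorem IsExecution.accept (hσ : IsExecution alg σ) {k : ℕ} {l s : Fin n}
    {a : AppendArgs Op} (hm : .appendRequest l s a ∈ (σ k).network)
    (hprev : PrevMatches ((σ k).server s).log a) :
    ∃ k' < k, ∃ M, IsLeaderOf (σ k') l a.term ∧ M <+: ((σ k').server l).log ∧
      M.length = a.prevLogIndex + a.entries.length ∧
      a.leaderCommit = ((σ k').server l).commitIndex ∧
      (alg = .paxos → M <+: ((σ k).server s).log ∨ M = ((σ k').server l).log) ∧
      ((M <+: ((σ k).server s).log ∧
          storeEntries ((σ k).server s).log a.prevLogIndex a.entries = ((σ k).server s).log) ∨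
        (¬ M <+: ((σ k).server s).log ∧
          storeEntries ((σ k).server s).log a.prevLogIndex a.entries = M)) :=
  hσ.accept_of_fromLeaders hm hprev fun k' hk' s' => (hσ.fromLeaders k' s').mono hk'

/-- The meaning of `matchIndex`. -/
theorem IsExecution.matchIndex (hσ : IsExecution alg σ) {k m : ℕ} {s j : Fin n}
    (h : ((σ k).server s).role = .leader) (hm0 : 0 < m)
    (hm : m ≤ ((σ k).server s).matchIndex j) :
    m ≤ ((σ k).server s).log.length ∧
      ∃ k', ((σ k').server j).currentTerm = ((σ k).server s).currentTerm ∧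
        ((σ k).server s).log.take m <+: ((σ k').server j).log := by
  induction k with
  | zero =>
    rw [hσ.init] at h
    cases h
  | succ k ih =>
    have hl := hσ.localStep k s
    obtain ⟨hT, hr | ⟨-, -, -, -, h0⟩⟩ := hl.leader_before h
    · have hlog := hσ.leader_log_step hr h
      have old (h' : m ≤ ((σ k).server s).matchIndex j) :
          m ≤ ((σ (k + 1)).server s).log.length ∧
            ∃ k', ((σ k').server j).currentTerm = ((σ (k + 1)).server s).currentTerm ∧
              ((σ (k + 1)).server s).log.take m <+: ((σ k').server j).log := by
        obtain ⟨h1, k', h2, h3⟩ := ih hr h'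
        refine ⟨h1.trans hlog.length_le, k', by rw [h2, hT], ?_⟩
        obtain ⟨r, hr⟩ := hlog
        rwa [← hr, List.take_append_of_le_length h1]
      by_cases h' : m ≤ ((σ k).server s).matchIndex j
      · exact old h'
      clear old
      generalize (σ (k + 1)).server s = v at hl h hm hlog
      cases hl with
      | quiet v hrole hterm hvote hlog hcommit hvotes hentries hmatch =>
        exact absurd (hmatch ▸ hm) h'
      | becomeLeader log' hrole => simp [hr] at hrole
      | restart | timeout | learnTerm => cases h
      | appendSucceeded q a T hmsg hrole ha hT' =>
        dsimp only at hm ⊢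
        by_cases hq : j = q
        · subst hq
          rw [Function.update_self] at hm
          replace hm : m ≤ a.prevLogIndex + a.entries.length := by omega
          obtain ⟨k₁, hk₁, hreq, haT, hk₁T, hk₁T', hprev, hstore⟩ := hσ.sent hmsg
          obtain ⟨k₂, hk₂, M, hlead, hM, hMl, -, -, hor⟩ := hσ.accept hreq hprev
          -- Since the request was sent, the leader's log has only grown; so `M`, with which the
          -- follower's log begins at `k₁ + 1`, is still a prefix of it.
          have hMs : M <+: ((σ k).server s).log :=
            hM.trans (hσ.leader_log_mono (by omega) hlead ⟨hr, ha.symm⟩)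
          rw [← hMl] at hm
          have htake : ((σ k).server s).log.take m = M.take m := by
            obtain ⟨r, hr⟩ := hMs
            rw [← hr, List.take_append_of_le_length hm]
          refine ⟨hm.trans hMs.length_le, k₁ + 1, by rw [hk₁T', hT'], ?_⟩
          rw [htake]
          refine (List.take_prefix _ _).trans ?_
          rcases hor with ⟨h1, h2⟩ | ⟨h1, h2⟩
          · rw [hstore, h2]
            exact h1
          · rw [hstore, h2]
        · rw [Function.update_of_ne hq] at hm
          exact absurd hm h'
      | _ => exact absurd hm h'
    · rw [h0] at hm
      exact absurd hm (by simpa using hm0.ne')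

/-- When the commit index of a leader moves to `N`, a majority has had the log of the leader up
to `N` in the term of the leader. -/
theorem IsExecution.quorum (hσ : IsExecution alg σ) {k N : ℕ} {s : Fin n}
    (h : ((σ k).server s).role = .leader) (hN : 0 < N)
    (hmaj : IsMajority (Finset.univ.filter fun j => j = s ∨ N ≤ ((σ k).server s).matchIndex j)) :
    ∃ Q : Finset (Fin n), IsMajority Q ∧ ∀ j ∈ Q, ∃ k',
      ((σ k').server j).currentTerm = ((σ k).server s).currentTerm ∧
        ((σ k).server s).log.take N <+: ((σ k').server j).log := by
  refine ⟨_, hmaj, fun j hj => ?_⟩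
  rcases (Finset.mem_filter.1 hj).2 with rfl | hj
  · exact ⟨k, rfl, List.take_prefix _ _⟩
  · exact (hσ.matchIndex h hN hj).2

end LogMatching

/-! ### Paxos: choices at a single index. -/

section Paxos

variable {n : ℕ} {Op : Type*} {σ : ℕ → State n Op}

/-- In term `t`, a majority has stored `op` at index `i` with term `t`. -/
def Chosen (σ : ℕ → State n Op) (t i : ℕ) (op : Op) : Prop :=
  ∃ Q : Finset (Fin n), IsMajority Q ∧ ∀ j ∈ Q, ∃ k, ((σ k).server j).currentTerm = t ∧
    entryAt ((σ k).server j).log i = some ⟨op, t⟩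

/-- The first term in which an operation is chosen at index `i`. -/
def FirstChosen (σ : ℕ → State n Op) (t i : ℕ) (op : Op) : Prop :=
  Chosen σ t i op ∧ ∀ t' op', Chosen σ t' i op' → t ≤ t'

/-- A priori the first choice may be a different operation; `IsExecution.op_eq_of_firstChosen` will
exclude this. -/
theorem Chosen.exists_first {t i : ℕ} {op : Op} (h : Chosen σ t i op) :
    ∃ t' ≤ t, ∃ op', FirstChosen σ t' i op' := by
  classical
  have hex : ∃ t op, Chosen σ t i op := ⟨t, op, h⟩
  obtain ⟨op', hop'⟩ := Nat.find_spec hex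
  exact ⟨_, Nat.find_min' hex ⟨op, h⟩, op', hop', fun u o hu => Nat.find_min' hex ⟨o, hu⟩⟩

/-- What holds at time `k`: later leaders and acceptors keep chosen operations, and committed
operations have been chosen. -/
structure PaxosInv (σ : ℕ → State n Op) (k : ℕ) : Prop where
  leader : ∀ {t i op}, FirstChosen σ t i op → ∀ {s t'}, IsLeaderOf (σ k) s t' → t < t' →
    ∃ e, entryAt ((σ k).server s).log i = some e ∧ e.op = op ∧ t ≤ e.term
  acceptor : ∀ {t i op}, FirstChosen σ t i op → ∀ {j k'}, k' ≤ k →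
    ((σ k').server j).currentTerm = t → entryAt ((σ k').server j).log i = some ⟨op, t⟩ →
    ∃ e, entryAt ((σ k).server j).log i = some e ∧ t ≤ e.term
  commit : ∀ {s i}, 0 < i → i ≤ ((σ k).server s).commitIndex →
    ∃ e, entryAt ((σ k).server s).log i = some e ∧ ∃ t ≤ e.term, Chosen σ t i e.op

/-- In Paxos, the entries of a leader after its commit index are of its own term. -/
theorem IsExecution.paxos_term_eq (hσ : IsExecution .paxos σ) {k i : ℕ} {s : Fin n}
    {e : Entry Op} (h : ((σ k).server s).role = .leader)
    (hi : ((σ k).server s).commitIndex < i) (he : entryAt ((σ k).server s).log i = some e) :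
    e.term = ((σ k).server s).currentTerm := by
  induction k generalizing e with
  | zero =>
    rw [hσ.init] at h
    cases h
  | succ k ih =>
    have hl := hσ.localStep k s
    obtain ⟨hT, hr | ⟨-, -, hlog, hcommit, -⟩⟩ := hl.leader_before h
    · have ih' := fun {e} => ih (e := e) hr
      rw [hT]
      generalize (σ (k + 1)).server s = v at hl h hi he hT
      cases hl with
      | quiet v hrole hterm hvote hlog hcommit => exact ih' (hcommit ▸ hi) (hlog ▸ he)
      | becomeLeader log' hrole => simp [hr] at hrole
      | clientRequest op hrole =>
        rcases entryAt_concat he with he | ⟨-, rfl⟩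
        · exact ih' hi he
        · rfl
      | advanceCommit N hrole hN => exact ih' (hN.trans hi) he
      | restart | timeout | learnTerm => cases h
      | acceptAppend l a hm hterm hprev =>
        obtain ⟨k', -, hne, hl, -⟩ := hσ.appendRequest_args hm
        exact absurd (hσ.leader_unique hl ⟨hr, hterm.symm⟩) hne
      | _ => exact ih' hi he
    · have := hlog.2 i (hcommit ▸ hi)
      rw [he] at this
      rw [hT]
      exact this.1

/-- An entry of a later term was in the log of that term's leader, where the invariant fixes the
operation; an entry of term `t` equals the chosen one by log matching. For this reason the acceptor
clause of `PaxosInv` only has to bound the term. -/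
theorem IsExecution.op_eq_of_firstChosen (hσ : IsExecution .paxos σ) {k t i : ℕ} {op : Op}
    (hinv : ∀ m ≤ k, PaxosInv σ m) (hf : FirstChosen σ t i op) {s : Fin n} {e : Entry Op}
    (he : entryAt ((σ k).server s).log i = some e) (ht : t ≤ e.term) : e.op = op := by
  rcases ht.lt_or_eq with ht | ht
  · obtain ⟨k', hk', s', hs', hp⟩ := hσ.fromLeaders k s i e he
    obtain ⟨f, hf, hop, -⟩ := (hinv k' hk').leader hf hs' ht
    rw [← entryAt_take_of_le le_rfl] at he
    rw [entryAt_of_isPrefix hp he] at hf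
    rwa [Option.some.inj hf]
  · obtain ⟨Q, hQ, h⟩ := hf.1
    -- A majority meets itself, so it is nonempty.
    obtain ⟨j, hj, -⟩ := exists_mem_of_isMajority hQ hQ
    obtain ⟨k', -, hk'⟩ := h j hj
    rw [(hσ.agree k k' s j).eq he hk' ht.symm]

/-- If the log changes, it becomes the sender's entire log, because a nonempty Paxos request carries
everything from `nextIndex` on. A sender of a later term has `op` by the invariant. If the sender's
term is `t`, the log up to `i` is comparable with the sender's log, and a shorter sender's log would
have changed nothing. -/
theorem IsExecution.accept_of_firstChosen (hσ : IsExecution .paxos σ) {k t i : ℕ} {op : Op}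
    (hinv : ∀ m ≤ k, PaxosInv σ m) (hf : FirstChosen σ t i op) {l s : Fin n} {e : Entry Op}
    (he : entryAt ((σ k).server s).log i = some e) (ht : t ≤ e.term)
    {a : AppendArgs Op} (hm : .appendRequest l s a ∈ (σ k).network)
    (hterm : a.term = ((σ k).server s).currentTerm)
    (hprev : PrevMatches ((σ k).server s).log a) :
    ∃ e', entryAt (storeEntries ((σ k).server s).log a.prevLogIndex a.entries) i = some e' ∧
      e'.op = op ∧ t ≤ e'.term := by
  have hop := hσ.op_eq_of_firstChosen hinv hf he ht
  obtain ⟨k', hk', M, hl, hM, -, -, hpaxos, h⟩ := hσ.accept hm hprev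
  rcases h with ⟨-, h⟩ | ⟨hnot, h⟩
  · rw [h]
    exact ⟨e, he, hop, ht⟩
  · rw [h]
    obtain rfl := (hpaxos rfl).resolve_left hnot
    have heT := hσ.entry_term_le (mem_of_entryAt he)
    rw [← hterm] at heT
    rcases (ht.trans heT).lt_or_eq with hlt | heq
    · exact (hinv k' hk'.le).leader hf hl hlt
    · obtain ⟨m, -, s', hs', hp⟩ := hσ.fromLeaders k s i e he
      have : e.term = a.term := by omega
      rcases hσ.prefix_total (this ▸ hs') hl hp List.prefix_rfl with hle | hle
      · rw [← entryAt_take_of_le le_rfl] at he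
        exact ⟨e, entryAt_of_isPrefix hle he, hop, ht⟩
      · exact absurd (hle.trans (List.take_prefix _ _)) hnot

/-- Some voter stored the chosen entry and, when voting, still had an entry of term at least `t` at
`i`. So the greatest collected term there is at least `t`, which determines the operation. Indices
up to the commit index are not merged and rest on the commit clause. -/
theorem IsExecution.elect_of_firstChosen (hσ : IsExecution .paxos σ) {k t i : ℕ} {op : Op}
    (hinv : ∀ m ≤ k, PaxosInv σ m) (hf : FirstChosen σ t i op) {s : Fin n}
    {log' : List (Entry Op)} (hrole : ((σ k).server s).role = .candidate)
    (hvotes : IsMajority ((σ k).server s).votes) (hlog : IsLeaderLog .paxos ((σ k).server s) log')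
    (ht : t < ((σ k).server s).currentTerm) :
    ∃ e, entryAt log' i = some e ∧ e.op = op ∧ t ≤ e.term := by
  obtain ⟨Q, hQ, hacc⟩ := hf.1
  obtain ⟨j, hj, hjv⟩ := exists_mem_of_isMajority hQ hvotes
  obtain ⟨k₁, hk₁T, hk₁⟩ := hacc j hj
  rcases le_or_gt i ((σ k).server s).commitIndex with hi | hi
  · obtain ⟨e, he, t₀, ht₀, hch⟩ := (hinv k le_rfl).commit (entryAt_bounds hk₁).1 hi
    -- Minimality enters here: no term before `t` chooses anything at `i`.
    have hte : t ≤ e.term := (hf.2 _ _ hch).trans ht₀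
    exact ⟨e, by rw [entryAt_eq_of_take_eq hlog.1 hi, he],
      hσ.op_eq_of_firstChosen hinv hf he hte, hte⟩
  · obtain ⟨k₂, hk₂, hk₂T, hsub⟩ := hσ.paxos_votes hrole hjv
    -- The entry was stored in term `t` and the vote cast in a greater term, so storing came first.
    have hk₁₂ : k₁ ≤ k₂ := by
      by_contra! hlt
      have := hσ.term_mono j hlt.le
      dsimp only at this
      omega
    obtain ⟨e, he, hte⟩ := (hinv k₂ hk₂).acceptor hf hk₁₂ hk₁T hk₁
    have hmem := hsub (show (i, e) ∈ _ from ⟨hi, he⟩)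
    have hmerge := hlog.2 i hi
    cases he' : entryAt log' i with
    | none =>
      rw [he'] at hmerge
      exact absurd hmem (hmerge e)
    | some e' =>
      rw [he'] at hmerge
      obtain ⟨hT, f, hfm, hop, hmax⟩ := hmerge
      obtain ⟨k₃, hk₃, v, -, hfv⟩ := hσ.paxos_entries hrole hfm
      refine ⟨e', rfl, ?_, hT ▸ ht.le⟩
      rw [← hop]
      exact hσ.op_eq_of_firstChosen (fun m hm => hinv m (hm.trans hk₃)) hf hfv
        (hte.trans (hmax e hmem))

theorem IsExecution.paxosInv_zero (hσ : IsExecution .paxos σ) : PaxosInv σ 0 where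
  leader _ s t' hs _ := by
    have := hs.1
    rw [hσ.init] at this
    cases this
  acceptor _ j k' hk' _ he := by
    obtain rfl := Nat.le_zero.1 hk'
    exact ⟨_, he, le_rfl⟩
  commit h0 hi := by
    rw [hσ.init] at hi
    exact absurd h0 (by simpa [Server.init] using hi)

theorem IsExecution.paxosInv_succ (hσ : IsExecution .paxos σ) {k : ℕ}
    (hinv : ∀ m ≤ k, PaxosInv σ m) : PaxosInv σ (k + 1) where
  leader {t i op} hf s t' hs ht := by
    have hl := hσ.localStep k s
    obtain ⟨hT, hr | ⟨hr, hvotes, hlog, -, -⟩⟩ := hl.leader_before hs.1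
    · obtain ⟨e, he, h⟩ := (hinv k le_rfl).leader hf ⟨hr, hT ▸ hs.2⟩ ht
      exact ⟨e, entryAt_of_isPrefix (hσ.leader_log_step hr hs.1) he, h⟩
    · exact hσ.elect_of_firstChosen hinv hf hr hvotes hlog (by rwa [← hT, hs.2])
  acceptor {t i op} hf j k' hk' hk'T he' := by
    rcases Nat.le_succ_iff.1 hk' with hk' | rfl
    swap
    · exact ⟨_, he', le_rfl⟩
    obtain ⟨e, he, hte⟩ := (hinv k le_rfl).acceptor hf hk' hk'T he'
    have hl := hσ.localStep k j
    generalize (σ (k + 1)).server j = v at hl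
    cases hl with
    | quiet v hrole hterm hvote hlog => exact ⟨e, by rw [hlog, he], hte⟩
    | becomeLeader log' hrole hvotes hlog =>
      have hle := hσ.term_mono j hk'
      dsimp only at hle
      rw [hk'T] at hle
      rcases hle.lt_or_eq with hlt | rfl
      · obtain ⟨f, hf, -, h⟩ := hσ.elect_of_firstChosen hinv hf hrole hvotes hlog hlt
        exact ⟨f, hf, h⟩
      -- The stored entry of this term presupposes an earlier leader of the term, which in Paxos is
      -- impossible while the term has a candidate.
      · obtain ⟨m, hm, s', hs', -⟩ := hσ.fromLeaders k' j i _ he'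
        exact absurd hs' (hσ.paxos_not_leader_of_candidate hrole (hm.trans hk'))
    | clientRequest op hrole => exact ⟨e, entryAt_of_isPrefix (List.prefix_append _ _) he, hte⟩
    | acceptAppend l a hm hterm hprev =>
      obtain ⟨f, hf, -, h⟩ := hσ.accept_of_firstChosen hinv hf he hte hm hterm hprev
      exact ⟨f, hf, h⟩
    | _ => exact ⟨e, he, hte⟩
  commit {s i} h0 hi := by
    have old := (hinv k le_rfl).commit (s := s) h0
    have hl := hσ.localStep k s
    generalize (σ (k + 1)).server s = v at hl hi
    cases hl with
    | quiet v hrole hterm hvote hlog hcommit =>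
      rw [hlog]
      exact old (hcommit ▸ hi)
    | becomeLeader log' hrole hvotes hlog =>
      obtain ⟨e, he, h⟩ := old hi
      exact ⟨e, by rw [← he]; exact entryAt_eq_of_take_eq hlog.1 hi, h⟩
    | clientRequest op hrole =>
      obtain ⟨e, he, h⟩ := old hi
      exact ⟨e, entryAt_of_isPrefix (List.prefix_append _ _) he, h⟩
    | advanceCommit N hrole hN hlen hmaj hcommit =>
      rcases le_or_gt i ((σ k).server s).commitIndex with hi' | hi'
      · exact old hi'
      obtain ⟨e, he⟩ := exists_entryAt (l := ((σ k).server s).log) h0 (hi.trans hlen)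
      -- Beyond the old commit index the entry has the leader's own term, so its replication counts
      -- as a choice. In Raft this is secured by `MayCommit`.
      have hT := hσ.paxos_term_eq hrole hi' he
      obtain ⟨Q, hQ, h⟩ := hσ.quorum hrole (h0.trans_le hi) hmaj
      refine ⟨e, he, e.term, le_rfl, Q, hQ, fun j hj => ?_⟩
      obtain ⟨k', hk'T, hk'⟩ := h j hj
      refine ⟨k', hk'T.trans hT.symm, entryAt_of_isPrefix hk' ?_⟩
      rw [entryAt_take_of_le hi, he]
    | restart => exact absurd h0 (by simpa [Server.init] using hi)
    | acceptAppend l a hm hterm hprev =>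
      dsimp only at hi ⊢
      rcases le_max_iff.1 hi with hi | hi
      · obtain ⟨e, he, t₀, ht₀, hch⟩ := old hi
        -- The term `t₀` may exceed that of the replacing entry; the first choosing term cannot.
        obtain ⟨t, ht, op, hf⟩ := hch.exists_first
        obtain ⟨e', he', rfl, h⟩ :=
          hσ.accept_of_firstChosen hinv hf he (ht.trans ht₀) hm hterm hprev
        exact ⟨e', he', t, h, hf.1⟩
      -- The index is committed at the sender and lies within `M`, so the sender's commit clause at
      -- time `k'` applies.
      · obtain ⟨k', hk', M, -, hM, hMl, hc, -, h⟩ := hσ.accept hm hprev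
        rw [← hMl, hc, le_min_iff] at hi
        obtain ⟨e, he, hch⟩ := (hinv k' hk'.le).commit h0 hi.1
        rw [entryAt_eq_of_isPrefix hM hi.2] at he
        refine ⟨e, ?_, hch⟩
        rcases h with ⟨h1, h2⟩ | ⟨h1, h2⟩
        · rw [h2]
          exact entryAt_of_isPrefix h1 he
        · rw [h2, he]
    | _ => exact old hi

theorem IsExecution.paxosInv (hσ : IsExecution .paxos σ) (k : ℕ) : PaxosInv σ k := by
  induction k using Nat.strong_induction_on with
  | _ k ih =>
    cases k with
    | zero => exact hσ.paxosInv_zero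
    | succ k => exact hσ.paxosInv_succ fun m hm => ih m (by omega)

theorem IsExecution.paxos_leader_completeness (hσ : IsExecution .paxos σ) {op : Op} {i t : ℕ}
    (hcommit : CommittedInTerm σ op i t) {t' : ℕ} (ht : t < t') {k : ℕ} {s : Fin n}
    (hs : IsLeaderOf (σ k) s t') : HasOpAt (σ k) s i op := by
  obtain ⟨m, s', hs', ⟨e, he, rfl⟩, hi⟩ := hcommit
  obtain ⟨f, hf, t₀, ht₀, hch⟩ := (hσ.paxosInv m).commit (entryAt_bounds he).1 hi
  obtain rfl : e = f := Option.some.inj (he.symm.trans hf)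
  obtain ⟨u, hu, op, hfirst⟩ := hch.exists_first
  have hop := hσ.op_eq_of_firstChosen (fun m _ => hσ.paxosInv m) hfirst he (hu.trans ht₀)
  have heT := hσ.entry_term_le (mem_of_entryAt he)
  rw [hs'.2] at heT
  obtain ⟨g, hg, hgop, -⟩ := (hσ.paxosInv k).leader hfirst hs (by omega)
  exact ⟨g, hg, hgop.trans hop.symm⟩

end Paxos

/-! ### Raft: choices of whole prefixes. -/

section Raft

variable {n : ℕ} {Op : Type*} {alg : Algorithm} {σ : ℕ → State n Op}

/-- The list `P` ends with an entry of term `t`, and in term `t` a majority has had a log that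
starts with `P`. -/
def ChosenPrefix (σ : ℕ → State n Op) (t : ℕ) (P : List (Entry Op)) : Prop :=
  (∃ e, entryAt P P.length = some e ∧ e.term = t) ∧
    ∃ Q : Finset (Fin n), IsMajority Q ∧ ∀ j ∈ Q, ∃ k, ((σ k).server j).currentTerm = t ∧
      P <+: ((σ k).server j).log

/-- The last entry of `P` has term `t`, which ties all of `P` to the leader of `t`. -/
theorem ChosenPrefix.exists_leader (hσ : IsExecution alg σ) {t : ℕ} {P : List (Entry Op)}
    (h : ChosenPrefix σ t P) : ∃ k s, IsLeaderOf (σ k) s t ∧ P <+: ((σ k).server s).log := by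
  obtain ⟨⟨e, he, rfl⟩, Q, hQ, hacc⟩ := h
  obtain ⟨j, hj, -⟩ := exists_mem_of_isMajority hQ hQ
  obtain ⟨k, -, hk⟩ := hacc j hj
  obtain ⟨m, -, s, hs, hp⟩ := hσ.fromLeaders k j _ e (entryAt_of_isPrefix hk he)
  refine ⟨m, s, hs, ?_⟩
  rwa [← List.prefix_iff_eq_take.1 hk] at hp

/-- What holds at time `k`: later leaders and acceptors keep chosen prefixes, and committed
prefixes have been chosen. -/
structure RaftInv (σ : ℕ → State n Op) (k : ℕ) : Prop where
  leader : ∀ {t P}, ChosenPrefix σ t P → ∀ {s t'}, IsLeaderOf (σ k) s t' → t < t' →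
    P <+: ((σ k).server s).log
  acceptor : ∀ {t P}, ChosenPrefix σ t P → ∀ {j k'}, k' ≤ k →
    ((σ k').server j).currentTerm = t → P <+: ((σ k').server j).log →
    P <+: ((σ k).server j).log
  commit : ∀ {s c}, 0 < c → c ≤ ((σ k).server s).commitIndex →
    ∃ t ≤ ((σ k).server s).currentTerm, ∃ P, ChosenPrefix σ t P ∧ c ≤ P.length ∧
      P.take c <+: ((σ k).server s).log

/-- A changed log is a prefix `M` of the sender's log. It is comparable with `R`: a sender of a
later term has `P`, and a sender of term `t` is the leader from which `P` stems. If `M` were a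
prefix of `R`, nothing would have changed. A general `R` is needed because a server may have only
the committed beginning of `P`. -/
theorem IsExecution.accept_of_chosenPrefix (hσ : IsExecution alg σ) {k t : ℕ}
    {P R : List (Entry Op)} (hinv : ∀ m ≤ k, RaftInv σ m) (hP : ChosenPrefix σ t P)
    (hRP : R <+: P) {l s : Fin n} (hR : R <+: ((σ k).server s).log)
    (ht : t ≤ ((σ k).server s).currentTerm)
    {a : AppendArgs Op} (hm : .appendRequest l s a ∈ (σ k).network)
    (hterm : a.term = ((σ k).server s).currentTerm)
    (hprev : PrevMatches ((σ k).server s).log a) :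
    R <+: storeEntries ((σ k).server s).log a.prevLogIndex a.entries := by
  obtain ⟨k', hk', M, hl, hM, -, -, -, h⟩ := hσ.accept hm hprev
  rcases h with ⟨-, h⟩ | ⟨hnot, h⟩
  · rwa [h]
  · rw [h]
    have key : R <+: M ∨ M <+: R := by
      rw [← hterm] at ht
      rcases ht.lt_or_eq with hlt | rfl
      · exact Consensus.prefix_total (hRP.trans ((hinv k' hk'.le).leader hP hl hlt)) hM
      · obtain ⟨m, s', hs', hp⟩ := hP.exists_leader hσ
        exact hσ.prefix_total hs' hl (hRP.trans hp) hM
    exact key.resolve_right fun hMR => hnot (hMR.trans hR)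

/-- A common voter `j` still has `P` when it votes. If the candidate's last term is greater than the
voter's, the leader of that term had `P`; if it is equal, both logs are prefixes of logs of one
leader, and the candidate's is at least as long. -/
theorem IsExecution.elect_of_chosenPrefix (hσ : IsExecution .raft σ) {k t : ℕ}
    {P : List (Entry Op)} (hinv : ∀ m ≤ k, RaftInv σ m) (hP : ChosenPrefix σ t P) {s : Fin n}
    (hrole : ((σ k).server s).role = .candidate)
    (hvotes : IsMajority ((σ k).server s).votes) (ht : t < ((σ k).server s).currentTerm) :
    P <+: ((σ k).server s).log := by
  obtain ⟨k₀, s₀, hs₀, hPs₀⟩ := hP.exists_leader hσ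
  have hPt : ∀ e ∈ P, e.term ≤ t := fun e he =>
    (hσ.entry_term_le (hPs₀.subset he)).trans_eq hs₀.2
  obtain ⟨⟨e, he, het⟩, Q, hQ, hacc⟩ := id hP
  obtain ⟨j, hj, hjv⟩ := exists_mem_of_isMajority hQ hvotes
  obtain ⟨k₁, hk₁T, hk₁⟩ := hacc j hj
  obtain ⟨k₂, hk₂, hk₂T, -, hup⟩ := hσ.raft_votes hrole hjv
  have hk₁₂ : k₁ ≤ k₂ := by
    by_contra! hlt
    have := hσ.term_mono j hlt.le
    dsimp only at this
    omega
  have hPj := (hinv k₂ hk₂).acceptor hP hk₁₂ hk₁T hk₁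
  obtain ⟨g, hg⟩ := exists_entryAt (l := ((σ k₂).server j).log)
    ((entryAt_bounds he).1.trans_le hPj.length_le) le_rfl
  obtain ⟨k₃, hk₃, s₃, hs₃, hp₃⟩ := hσ.fromLeaders k₂ j _ g hg
  rw [List.take_length] at hp₃
  have htg : t ≤ g.term := by
    have := hσ.entry_term_le (hp₃.subset (hPj.subset (mem_of_entryAt he)))
    rwa [hs₃.2, het] at this
  rw [UpToDate, termAt_of_entryAt hg] at hup
  have hg0 : 0 < g.term := (hσ.fromLeaders k₂ j).term_pos hσ (mem_of_entryAt hg)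
  -- As `g.term` is positive, the candidate's last term is not the default `0` of an empty log.
  obtain ⟨f, hf, hfterm⟩ := exists_of_termAt_pos
    (l := ((σ k).server s).log) (i := ((σ k).server s).log.length) (by omega)
  rw [← hfterm] at hup
  obtain ⟨k₄, hk₄, s₄, hs₄, hp₄⟩ := hσ.fromLeaders k s _ f hf
  rw [List.take_length] at hp₄
  rcases hup with hlt | ⟨heq, hlen⟩
  · have hP₄ := (hinv k₄ hk₄).leader hP hs₄ (by omega)
    -- The candidate's log cannot be a prefix of `P`, since its last entry has a term greater than
    -- `t`.
    refine (Consensus.prefix_total hP₄ hp₄).resolve_right fun hle => ?_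
    have := hPt f (hle.subset (mem_of_entryAt hf))
    omega
  · refine hPj.trans ?_
    rcases hσ.prefix_total hs₃ (heq ▸ hs₄) hp₃ hp₄ with hle | hle
    · exact hle
    · rw [hle.eq_of_length_le hlen]

theorem IsExecution.raftInv_zero (hσ : IsExecution .raft σ) : RaftInv σ 0 where
  leader _ s t' hs _ := by
    have := hs.1
    rw [hσ.init] at this
    cases this
  acceptor _ j k' hk' _ hP := by
    obtain rfl := Nat.le_zero.1 hk'
    exact hP
  commit h0 hi := by
    rw [hσ.init] at hi
    exact absurd h0 (by simpa [Server.init] using hi)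

theorem IsExecution.raftInv_succ (hσ : IsExecution .raft σ) {k : ℕ}
    (hinv : ∀ m ≤ k, RaftInv σ m) : RaftInv σ (k + 1) where
  leader {t P} hP s t' hs ht := by
    have hl := hσ.localStep k s
    obtain ⟨hT, hr | ⟨hr, hvotes, hlog, -, -⟩⟩ := hl.leader_before hs.1
    · exact ((hinv k le_rfl).leader hP ⟨hr, hT ▸ hs.2⟩ ht).trans (hσ.leader_log_step hr hs.1)
    · rw [show ((σ (k + 1)).server s).log = _ from hlog]
      exact hσ.elect_of_chosenPrefix hinv hP hr hvotes (by rwa [← hT, hs.2])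
  acceptor {t P} hP j k' hk' hk'T hPj := by
    rcases Nat.le_succ_iff.1 hk' with hk' | rfl
    swap
    · exact hPj
    have old := (hinv k le_rfl).acceptor hP hk' hk'T hPj
    have hl := hσ.localStep k j
    generalize (σ (k + 1)).server j = v at hl
    cases hl with
    | quiet v hrole hterm hvote hlog => rwa [hlog]
    | becomeLeader log' hrole hvotes hlog =>
      obtain rfl : log' = _ := hlog
      exact old
    | clientRequest op hrole => exact old.trans (List.prefix_append _ _)
    | acceptAppend l a hm hterm hprev =>
      exact hσ.accept_of_chosenPrefix hinv hP List.prefix_rfl old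
        (hk'T.symm.trans_le (hσ.term_mono j hk')) hm hterm hprev
    | _ => exact old
  commit {s c} h0 hc := by
    have old := (hinv k le_rfl).commit (s := s) h0
    have hl := hσ.localStep k s
    generalize (σ (k + 1)).server s = v at hl hc
    cases hl with
    | quiet v hrole hterm hvote hlog hcommit =>
      rw [hlog, hterm]
      exact old (hcommit ▸ hc)
    | timeout t' hterm =>
      obtain ⟨t, ht, h⟩ := old hc
      exact ⟨t, ht.trans hterm.lt.le, h⟩
    | learnTerm t' hterm =>
      obtain ⟨t, ht, h⟩ := old hc
      exact ⟨t, ht.trans hterm.le, h⟩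
    | becomeLeader log' hrole hvotes hlog =>
      obtain rfl : log' = _ := hlog
      exact old hc
    | clientRequest op hrole =>
      obtain ⟨t, ht, P, hP, hcP, h⟩ := old hc
      exact ⟨t, ht, P, hP, hcP, h.trans (List.prefix_append _ _)⟩
    | advanceCommit N hrole hN hlen hmaj hcommit =>
      have hN0 : 0 < N := by omega
      have hlenN : (((σ k).server s).log.take N).length = N := List.length_take_of_le hlen
      obtain ⟨e, he⟩ := exists_entryAt (l := ((σ k).server s).log) hN0 hlen
      -- The prefix ends at `N`, where `MayCommit` provides the current term that `ChosenPrefix`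
      -- requires of the last entry.
      refine ⟨_, le_rfl, ((σ k).server s).log.take N, ⟨⟨e, ?_, ?_⟩, hσ.quorum hrole hN0 hmaj⟩,
        by rwa [hlenN], (List.take_prefix _ _).trans (List.take_prefix _ _)⟩
      · rw [hlenN, entryAt_take_of_le le_rfl, he]
      · rw [← termAt_of_entryAt he]
        exact hcommit
    | restart => exact absurd h0 (by simpa [Server.init] using hc)
    | acceptAppend l a hm hterm hprev =>
      dsimp only at hc ⊢
      rcases le_max_iff.1 hc with hc | hc
      · obtain ⟨t, ht, P, hP, hcP, h⟩ := old hc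
        exact ⟨t, ht, P, hP, hcP, hσ.accept_of_chosenPrefix hinv hP (List.take_prefix _ _) h ht
          hm hterm hprev⟩
      · obtain ⟨k', hk', M, hlead, hM, hMl, hcl, -, h⟩ := hσ.accept hm hprev
        rw [← hMl, hcl, le_min_iff] at hc
        obtain ⟨t, ht, P, hP, hcP, h'⟩ := (hinv k' hk'.le).commit h0 hc.1
        rw [hlead.2, hterm] at ht
        refine ⟨t, ht, P, hP, hcP, ?_⟩
        have hPM : P.take c <+: M := List.prefix_of_prefix_length_le h' hM
          ((List.length_take_le _ _).trans hc.2)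
        rcases h with ⟨h1, h2⟩ | ⟨h1, h2⟩
        · rw [h2]
          exact hPM.trans h1
        · rwa [h2]
    | _ => exact old hc

theorem IsExecution.raftInv (hσ : IsExecution .raft σ) (k : ℕ) : RaftInv σ k := by
  induction k using Nat.strong_induction_on with
  | _ k ih =>
    cases k with
    | zero => exact hσ.raftInv_zero
    | succ k => exact hσ.raftInv_succ fun m hm => ih m (by omega)

theorem IsExecution.raft_leader_completeness (hσ : IsExecution .raft σ) {op : Op} {i t : ℕ}
    (hcommit : CommittedInTerm σ op i t) {t' : ℕ} (ht : t < t') {k : ℕ} {s : Fin n}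
    (hs : IsLeaderOf (σ k) s t') : HasOpAt (σ k) s i op := by
  obtain ⟨m, s', hs', ⟨e, he, hop⟩, hi⟩ := hcommit
  obtain ⟨t₀, ht₀, P, hP, hiP, hp⟩ := (hσ.raftInv m).commit (entryAt_bounds he).1 hi
  rw [hs'.2] at ht₀
  have hPs := (hσ.raftInv k).leader hP hs (by omega)
  rw [entryAt_eq_of_isPrefix hp (by simp [hiP])] at he
  exact ⟨e, entryAt_of_isPrefix ((List.take_prefix _ _).trans hPs) he, hop⟩

end Raft

end Consensus

theorem mainTheorem1 (alg : Consensus.Algorithm) (n : ℕ) (Op : Type*)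
    (σ : ℕ → Consensus.State n Op) (hσ : Consensus.IsExecution alg σ)
    (op : Op) (i t : ℕ) (hcommit : Consensus.CommittedInTerm σ op i t)
    (t' : ℕ) (ht : t < t') (k : ℕ) (s : Fin n) (hs : Consensus.IsLeaderOf (σ k) s t') :
    Consensus.HasOpAt (σ k) s i op := by
  cases alg with
  | paxos => exact hσ.paxos_leader_completeness hcommit ht hs
  | raft => exact hσ.raft_leader_completeness hcommit ht hs
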